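/- Let $\mathfrak A$ and $\mathfrak B$ be (not necessarily unital) $C^*$-algebras. An $\mathfrak A$-$\mathfrak B$ Hilbert bimodule is a Hilbert $C^*$-module $\mathcal E$ over $\mathfrak B$ (complete, with right $\mathfrak B$-action) together with a $*$-homomorphism from $\mathfrak A$ into the adjointable operators on $\mathcal E$ that is nondegenerate, i.e. the linear span of the elements $A\Psi$ ($A\in\mathfrak A$, $\Psi\in\mathcal E$) is dense in $\mathcal E$. The $\mathfrak A$-$\mathfrak B$ Hilbert bimodules form a category $(\mathfrak A,\mathfrak B)$, whose arrows are the adjointable $\mathfrak A$-linear maps. For $\mathcal E\in(\mathfrak A,\mathfrak B)$ and $\mathcal F\in(\mathfrak B,\mathfrak C)$ let $\mathcal E\,\hat\otimes_{\mathfrak B}\mathcal F\in(\mathfrak A,\mathfrak C)$ be Rieffel's interior tensor product, the Hausdorff completion of the algebraic tensor product in the $\mathfrak C$-valued inner product $\langle\Psi\otimes\Phi,\Psi'\otimes\Phi'\rangle_{\mathfrak C}=\langle\Phi,\langle\Psi,\Psi'\rangle_{\mathfrak B}\Phi'\rangle_{\mathfrak C}$, and let $1_{\mathfrak B}\in(\mathfrak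 B,\mathfrak B)$ be $\mathfrak B$ itself, with $\langle A,B\rangle_{\mathfrak B}=A^*B$ and the actions by left and right multiplication. Suppose that $\mathfrak A$ and $\mathfrak B$ are isomorphic objects in the bicategory $[\mathsf C^*]$ of $C^*$-algebras and Hilbert bimodules, that is, there are $\mathcal E\in(\mathfrak A,\mathfrak B)$ and $\mathcal F\in(\mathfrak B,\mathfrak A)$ such that $\mathcal E\,\hat\otimes_{\mathfrak B}\mathcal F\cong 1_{\mathfrak A}$ in the category $(\mathfrak A,\mathfrak A)$ and $\mathcal F\,\hat\otimes_{\mathfrak A}\mathcal E\cong 1_{\mathfrak B}$ in the category $(\mathfrak B,\mathfrak B)$. Let $\mathrm{Rep}(\mathfrak A)$ be the category whose objects are the nondegenerate $*$-representations of $\mathfrak A$ on complex Hilbert spaces and whose arrows are the bounded linear intertwiners, and likewise $\mathrm{Rep}(\mathfrak B)$. Then there is an equivalence of categories $G:\mathrm{Rep}(\mathfrak A)\to\mathrm{Rep}(\mathfrak B)$ that is complex linear on arrows and satisfies $G(T^*)=G(T)^*$ for every arrow $T$. -/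

import Mathlib

open scoped TensorProduct InnerProductSpace
open CategoryTheory

universe u

/-- A (right) semi-inner-product module over a C⋆-algebra `B`: a complex vector space `V` with a
right action of `B` and a positive semidefinite `B`-valued sesquilinear form, conjugate linear in
the first and `B`-linear in the second variable. An element of `B` is positive if it is of the form
`star b * b`. -/
class PreHilbertModule (B V : Type*) [NonUnitalCStarAlgebra B] [AddCommGroup V] [Module ℂ V] where
  /-- the right action `(x, b) ↦ x b` -/
  rsmul : V →ₗ[ℂ] B →ₗ[ℂ] V
  rsmul_mul (x : V) (b c : B) : rsmul x (b * c) = rsmul (rsmul x b) c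
  /-- the `B`-valued inner product -/
  form : V →ₗ⋆[ℂ] V →ₗ[ℂ] B
  form_rsmul (x y : V) (b : B) : form x (rsmul y b) = form x y * b
  star_form (x y : V) : star (form x y) = form y x
  form_self_nonneg (x : V) : ∃ b : B, form x x = star b * b

/-- A right inner product `B`-module whose norm is `‖x‖ = ‖⟨x, x⟩‖ ^ (1/2)`. It is a
Hilbert C⋆-module over `B` if moreover `E` is a complete normed (not only seminormed) space. -/
class HilbertModule (B E : Type*) [NonUnitalCStarAlgebra B] [SeminormedAddCommGroup E]
    [NormedSpace ℂ E] extends PreHilbertModule B E where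
  norm_sq_eq (x : E) : ‖x‖ ^ 2 = ‖form x x‖

namespace PreHilbertModule

section Basic

variable {B V : Type*} [NonUnitalCStarAlgebra B] [AddCommGroup V] [Module ℂ V]
  [PreHilbertModule B V]

lemma rsmul_form (x y : V) (b : B) : form (rsmul x b) y = star b * form x y := by
  rw [← star_form, form_rsmul, star_mul, star_form]

/-- The negative part `N = star R * R` of a self-adjoint element `P` of a C⋆-algebra. -/
lemma exists_negPart {M : Type*} [NonUnitalCStarAlgebra M] (P : M) (hP : IsSelfAdjoint P) :
    ∃ N R : M, star N = N ∧ N = star R * R ∧ N * P * N = - (star (R * N) * (R * N)) ∧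
      (N = 0 → ∃ Q : M, P = star Q * Q) := by
  let := CStarAlgebra.spectralOrder M
  have := CStarAlgebra.spectralOrderedRing M
  have hN0 : 0 ≤ P⁻ := CFC.negPart_nonneg P
  have hNs : star P⁻ = P⁻ := (IsSelfAdjoint.of_nonneg hN0).star_eq
  have hd : P = P⁺ - P⁻ := (CFC.posPart_sub_negPart P hP).symm
  obtain ⟨R, hR⟩ := CStarAlgebra.nonneg_iff_eq_star_mul_self.1 hN0
  refine ⟨P⁻, R, hNs, hR, ?_, fun h => ?_⟩
  · have : P⁻ * P * P⁻ = - (P⁻ * P⁻ * P⁻) := by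
      calc P⁻ * P * P⁻ = P⁻ * (P⁺ - P⁻) * P⁻ := by rw [← hd]
        _ = _ := by rw [mul_sub, CFC.negPart_mul_posPart, zero_sub, neg_mul]
    rw [this, star_mul, hNs, mul_assoc P⁻, mul_assoc P⁻, ← mul_assoc (star R), ← hR]
  · rw [h, sub_zero] at hd
    exact CStarAlgebra.nonneg_iff_eq_star_mul_self.1 (hd ▸ CFC.posPart_nonneg P)

/-- The Gram matrix of a finite family is positive, hence of the form `star Q * Q`. -/
lemma exists_gram {ι : Type*} [Fintype ι] (x : ι → V) :
    ∃ Q : ι → ι → B, ∀ i j, form (x i) (x j) = ∑ k, star (Q k i) * Q k j := by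
  let := CStarAlgebra.spectralOrder B
  have := CStarAlgebra.spectralOrderedRing B
  let P : CStarMatrix ι ι B := CStarMatrix.ofMatrix fun i j => form (x i) (x j)
  have hPij (i j) : P i j = form (x i) (x j) := rfl
  have hP : IsSelfAdjoint P := by
    ext i j
    exact star_form (x j) (x i)
  obtain ⟨N, R, hNs, hR, h1, hQ⟩ := exists_negPart P hP
  suffices h : N = 0 by
    obtain ⟨Q, hQ⟩ := hQ h
    refine ⟨fun i j => Q i j, fun i j => ?_⟩
    rw [← hPij, hQ, CStarMatrix.mul_apply]
    rfl
  have hZ : R * N = 0 := by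
    ext i j
    have hjj : ∑ k, star ((R * N) k j) * (R * N) k j
        = - form (∑ k, rsmul (x k) (N k j)) (∑ k, rsmul (x k) (N k j)) := by
      have e1 : (star (R * N) * (R * N)) j j = ∑ k, star ((R * N) k j) * (R * N) k j := by
        rw [CStarMatrix.mul_apply]; rfl
      have e2 : (N * P * N) j j
          = form (∑ k, rsmul (x k) (N k j)) (∑ k, rsmul (x k) (N k j)) := by
        have hst (k) : N j k = star (N k j) := by
          conv_lhs => rw [← hNs]
          rfl
        simp only [CStarMatrix.mul_apply, map_sum, LinearMap.sum_apply, form_rsmul, rsmul_form,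
          hst, hPij, Finset.sum_mul]
      rw [← e1, ← e2, h1]
      simp
    obtain ⟨b, hb⟩ := form_self_nonneg (B := B) (∑ k, rsmul (x k) (N k j))
    have hsum0 : ∑ k, star ((R * N) k j) * (R * N) k j = 0 := by
      refine le_antisymm ?_ (Finset.sum_nonneg fun k _ => star_mul_self_nonneg _)
      rw [hjj, hb, Left.neg_nonpos_iff]
      exact star_mul_self_nonneg _
    have := (Finset.sum_eq_zero_iff_of_nonneg (fun k _ => star_mul_self_nonneg _)).1 hsum0 i
      (Finset.mem_univ _)
    exact CStarRing.star_mul_self_eq_zero_iff _ |>.1 this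
  have hNN : N * N = 0 := by
    conv_lhs => lhs; rw [hR]
    rw [mul_assoc, hZ, mul_zero]
  rw [← CStarRing.star_mul_self_eq_zero_iff, hNs, hNN]

/-- The Cauchy-Schwarz inequality. -/
lemma norm_form_le (x y : V) :
    ‖form (B := B) x y‖ ≤ √‖form (B := B) x x‖ * √‖form (B := B) y y‖ := by
  let := CStarAlgebra.spectralOrder B
  have := CStarAlgebra.spectralOrderedRing B
  set b : B := form x y with hb
  have key (r : ℝ) (hr : 0 < r) (hxr : ‖form (B := B) x x‖ ≤ r) :
      ‖b‖ ^ 2 ≤ r * ‖form (B := B) y y‖ := by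
    obtain ⟨c, hc⟩ := form_self_nonneg (B := B) (rsmul x b - (r : ℂ) • y)
    have h0 : (0 : B) ≤ form (rsmul x b - (r : ℂ) • y) (rsmul x b - (r : ℂ) • y) := by
      rw [hc]; exact star_mul_self_nonneg _
    obtain ⟨d, hd⟩ := form_self_nonneg (B := B) x
    have hx0 : (0 : B) ≤ form x x := by rw [hd]; exact star_mul_self_nonneg _
    obtain ⟨e, he⟩ := form_self_nonneg (B := B) y
    have hyx : form y x = star b := by rw [hb, star_form]
    have h1 : (form (rsmul x b - (r : ℂ) • y) (rsmul x b - (r : ℂ) • y) : B)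
        = star b * form x x * b - r • (star b * b) - r • (star b * b)
          + r • r • form y y := by
      simp only [map_sub, LinearMap.sub_apply, map_smulₛₗ, LinearMap.smul_apply, form_rsmul,
        rsmul_form, hyx, ← hb, RingHom.id_apply, Complex.conj_ofReal, smul_sub]
      simp only [Complex.coe_smul]
      abel
    have h2 : star b * form x x * b ≤ r • (star b * b) := by
      calc star b * form x x * b ≤ ‖form (B := B) x x‖ • (star b * b) :=
            CStarAlgebra.star_left_conjugate_le_norm_smul
        _ ≤ r • (star b * b) := smul_le_smul_of_nonneg_right hxr (star_mul_self_nonneg _)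
    have h3 : r • (star b * b) ≤ r • r • (form y y : B) := by
      rw [h1] at h0
      have h4 : r • (star b * b) ≤ r • (star b * b) + (star b * form x x * b - r • (star b * b)
          - r • (star b * b) + r • r • form y y) := le_add_of_nonneg_right h0
      refine h4.trans ?_
      have h5 : r • (star b * b) + (star b * form x x * b - r • (star b * b)
          - r • (star b * b) + r • r • form y y)
          = (star b * form x x * b - r • (star b * b)) + r • r • form y y := by abel
      rw [h5]
      exact add_le_of_nonpos_left (sub_nonpos.2 h2)
    have h6 : star b * b ≤ r • (form y y : B) := (smul_le_smul_iff_of_pos_left hr).1 h3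
    have h7 := CStarAlgebra.norm_le_norm_of_nonneg_of_le (star_mul_self_nonneg b) h6
    rw [CStarRing.norm_star_mul_self, norm_smul, Real.norm_of_nonneg hr.le] at h7
    rwa [sq]
  have h : ‖b‖ ^ 2 ≤ ‖form (B := B) x x‖ * ‖form (B := B) y y‖ := by
    refine ge_of_tendsto (f := fun ε : ℝ => (‖form (B := B) x x‖ + ε) * ‖form (B := B) y y‖)
      (x := nhdsWithin 0 (Set.Ioi 0)) ?_ ?_
    · have : ContinuousAt
          (fun ε : ℝ => (‖form (B := B) x x‖ + ε) * ‖form (B := B) y y‖) 0 := by fun_prop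
      simpa using this.tendsto.mono_left nhdsWithin_le_nhds
    · filter_upwards [self_mem_nhdsWithin] with ε hε
      have hε' : 0 < ε := hε
      exact key _ (by positivity) (by linarith)
  rw [← Real.sqrt_mul (norm_nonneg _)]
  exact Real.le_sqrt_of_sq_le h

end Basic

section Seminorm

variable (B V : Type*) [NonUnitalCStarAlgebra B] [AddCommGroup V] [Module ℂ V]
  [PreHilbertModule B V]

/-- The space `V` with the seminorm `‖x‖ = ‖⟨x, x⟩‖ ^ (1/2)`. -/
def Pre (B V : Type*) [NonUnitalCStarAlgebra B] [AddCommGroup V] [Module ℂ V]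
    [PreHilbertModule B V] : Type _ := V

noncomputable instance : AddCommGroup (Pre B V) := inferInstanceAs (AddCommGroup V)

noncomputable instance : Module ℂ (Pre B V) := inferInstanceAs (Module ℂ V)

noncomputable instance : PreHilbertModule B (Pre B V) := inferInstanceAs (PreHilbertModule B V)

noncomputable instance : Norm (Pre B V) := ⟨fun x => √‖form (B := B) x x‖⟩

variable {B V} in
lemma Pre.norm_def (x : Pre B V) : ‖x‖ = √‖form (B := B) x x‖ := rfl

variable {B V} in
lemma Pre.norm_sq (x : Pre B V) : ‖x‖ ^ 2 = ‖form (B := B) x x‖ :=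
  Real.sq_sqrt (norm_nonneg _)

lemma Pre.core : SeminormedSpace.Core ℂ (Pre B V) where
  norm_nonneg _ := Real.sqrt_nonneg _
  norm_smul c x := by
    rw [Pre.norm_def, Pre.norm_def, ← Real.sqrt_sq (norm_nonneg c), ← Real.sqrt_mul (sq_nonneg _)]
    simp [norm_smul, sq, mul_assoc]
  norm_triangle x y := by
    have h1 : ‖x + y‖ ^ 2 ≤ (‖x‖ + ‖y‖) ^ 2 := by
      have hxy := norm_form_le (B := B) x y
      have hyx := norm_form_le (B := B) y x
      rw [← Pre.norm_def, ← Pre.norm_def] at hxy hyx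
      rw [Pre.norm_sq, add_sq, Pre.norm_sq, Pre.norm_sq]
      simp only [map_add, LinearMap.add_apply]
      refine (norm_add_le _ _).trans ((add_le_add (norm_add_le _ _) (norm_add_le _ _)).trans ?_)
      linarith
    exact abs_le_of_sq_le_sq' h1 (add_nonneg (Real.sqrt_nonneg _) (Real.sqrt_nonneg _)) |>.2

noncomputable instance : SeminormedAddCommGroup (Pre B V) :=
  SeminormedAddCommGroup.ofCore (Pre.core B V)

noncomputable instance : NormedSpace ℂ (Pre B V) where
  norm_smul_le c x := ((Pre.core B V).norm_smul c x).le

noncomputable instance : HilbertModule B (Pre B V) where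
  norm_sq_eq x := Pre.norm_sq x

end Seminorm

section Completion

variable {B V : Type*} [NonUnitalCStarAlgebra B] [SeminormedAddCommGroup V] [NormedSpace ℂ V]
  [HilbertModule B V]

open UniformSpace UniformSpace.Completion

lemma norm_form_le_mul (x y : V) : ‖form (B := B) x y‖ ≤ ‖x‖ * ‖y‖ := by
  have := norm_form_le (B := B) x y
  rwa [← HilbertModule.norm_sq_eq, ← HilbertModule.norm_sq_eq, Real.sqrt_sq (norm_nonneg _),
    Real.sqrt_sq (norm_nonneg _)] at this

lemma norm_rsmul_le (x : V) (b : B) : ‖rsmul x b‖ ≤ ‖b‖ * ‖x‖ := by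
  refine abs_le_of_sq_le_sq' ?_ (by positivity) |>.2
  rw [mul_pow, HilbertModule.norm_sq_eq (B := B) x,
    HilbertModule.norm_sq_eq (B := B) (rsmul x b), form_rsmul, rsmul_form]
  calc ‖star b * form x x * b‖ ≤ ‖star b‖ * ‖form (B := B) x x‖ * ‖b‖ :=
        (norm_mul_le _ _).trans (mul_le_mul_of_nonneg_right (norm_mul_le _ _) (norm_nonneg _))
    _ = ‖b‖ ^ 2 * ‖form (B := B) x x‖ := by rw [norm_star]; ring

/-- Right multiplication by `b` as a continuous map. -/
noncomputable def rsmulL (b : B) : V →L[ℂ] V :=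
  LinearMap.mkContinuous ((rsmul (B := B) (V := V)).flip b) ‖b‖
    fun x => norm_rsmul_le x b

lemma rsmulL_apply (b : B) (x : V) : rsmulL b x = rsmul x b := rfl

/-- The inner product as a continuous sesquilinear map. -/
noncomputable def formL : V →L⋆[ℂ] V →L[ℂ] B :=
  LinearMap.mkContinuous₂ (form (B := B) (V := V)) 1 fun x y => by
    rw [one_mul]; exact norm_form_le_mul x y

lemma continuous_form : Continuous fun p : V × V => form (B := B) p.1 p.2 := by
  change Continuous fun p : V × V => formL p.1 p.2
  fun_prop

/-- The inner product on the completion: the continuous extension of the given one. -/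
noncomputable def complForm (B : Type*) [NonUnitalCStarAlgebra B] [HilbertModule B V]
    (x y : Completion V) : B :=
  (isDenseInducing_coe.prodMap isDenseInducing_coe).extend
    (fun p : V × V => form (B := B) p.1 p.2) (x, y)

lemma complForm_coe (x y : V) : complForm B (x : Completion V) (y : Completion V) = form x y :=
  (isDenseInducing_coe.prodMap isDenseInducing_coe).extend_eq continuous_form (x, y)

variable (B) in
lemma continuous_complForm : Continuous fun p : Completion V × Completion V => complForm B p.1 p.2 := by
  let f : V →+ V →+ B :=
    { toFun := fun x => (form x).toAddMonoidHom
      map_zero' := by ext; simp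
      map_add' := fun x y => by ext; simp }
  have : Continuous fun p : V × V => f p.1 p.2 := continuous_form
  exact (isDenseInducing_toCompl (V)).extend_Z_bilin (isDenseInducing_toCompl (V)) this

variable (B) in
lemma continuous_complForm' {X : Type*} [TopologicalSpace X] {f g : X → Completion V}
    (hf : Continuous f) (hg : Continuous g) : Continuous fun x => complForm B (f x) (g x) :=
  (continuous_complForm B).comp (hf.prodMk hg)

lemma complForm_add_right (x y z : Completion V) :
    complForm B x (y + z) = complForm B x y + complForm B x z := by
  refine Completion.induction_on₃ x y z (isClosed_eq (continuous_complForm' B ?_ ?_)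
    ((continuous_complForm' B ?_ ?_).add (continuous_complForm' B ?_ ?_))) fun a b c => ?_
  any_goals fun_prop
  rw [← coe_add]
  simp only [complForm_coe, map_add]

lemma complForm_smul_right (c : ℂ) (x y : Completion V) :
    complForm B x (c • y) = c • complForm B x y := by
  have h1 : Continuous fun p : Completion V × Completion V => c • p.2 :=
    continuous_snd.const_smul c
  refine Completion.induction_on₂ x y (isClosed_eq (continuous_complForm' B continuous_fst h1)
    ((continuous_complForm B).const_smul c)) fun a b => ?_
  have h : c • (b : Completion V) = ((c • b : V) : Completion V) := (coe_smul c b).symm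
  rw [h, complForm_coe, complForm_coe, map_smul]

lemma star_complForm (x y : Completion V) : star (complForm B x y) = complForm B y x := by
  refine Completion.induction_on₂ x y (isClosed_eq (continuous_complForm' B ?_ ?_).star
    (continuous_complForm' B ?_ ?_)) fun a b => ?_
  any_goals fun_prop
  simp only [complForm_coe, star_form]

lemma complForm_rsmul (x y : Completion V) (b : B) :
    complForm B x ((rsmulL b).completion y) = complForm B x y * b := by
  refine Completion.induction_on₂ x y (isClosed_eq (continuous_complForm' B ?_ ?_)
    ((continuous_complForm' B ?_ ?_).mul continuous_const)) fun a c => ?_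
  any_goals fun_prop
  rw [ContinuousLinearMap.completion_apply_coe, complForm_coe, complForm_coe, rsmulL_apply,
    form_rsmul]

lemma complForm_self_nonneg (x : Completion V) : ∃ b : B, complForm B x x = star b * b := by
  let := CStarAlgebra.spectralOrder B
  have := CStarAlgebra.spectralOrderedRing B
  rw [← CStarAlgebra.nonneg_iff_eq_star_mul_self]
  refine Completion.induction_on x (isClosed_le continuous_const
    (continuous_complForm' B continuous_id continuous_id)) fun a => ?_
  rw [complForm_coe]
  exact CStarAlgebra.nonneg_iff_eq_star_mul_self.2 (form_self_nonneg a)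

lemma norm_sq_complForm (x : Completion V) : ‖x‖ ^ 2 = ‖complForm B x x‖ := by
  refine Completion.induction_on x (isClosed_eq (by fun_prop)
    (continuous_complForm' B continuous_id continuous_id).norm) fun a => ?_
  rw [complForm_coe, norm_coe, HilbertModule.norm_sq_eq (B := B)]

/-- The right action on the completion. -/
noncomputable def complRsmul : Completion V →ₗ[ℂ] B →ₗ[ℂ] Completion V :=
  LinearMap.mk₂ ℂ (fun x b => (rsmulL b).completion x)
    (fun x y b => map_add _ x y) (fun c x b => map_smul _ c x)
    (fun x b c => by
      refine Completion.induction_on x (isClosed_eq (rsmulL (b + c)).completion.continuous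
        ((rsmulL b).completion.continuous.add (rsmulL c).completion.continuous)) fun a => ?_
      rw [ContinuousLinearMap.completion_apply_coe, ContinuousLinearMap.completion_apply_coe,
        ContinuousLinearMap.completion_apply_coe, ← coe_add, rsmulL_apply, map_add]
      rfl)
    (fun c x b => by
      refine Completion.induction_on x (isClosed_eq (rsmulL (c • b)).completion.continuous
        ((rsmulL b).completion.continuous.const_smul c)) fun a => ?_
      have h : c • ((rsmulL b a : V) : Completion V) = ((c • rsmulL b a : V) : Completion V) :=
        (coe_smul c _).symm
      rw [ContinuousLinearMap.completion_apply_coe, ContinuousLinearMap.completion_apply_coe,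
        h, rsmulL_apply, map_smul]
      rfl)

/-- The completion of a semi-inner-product module is a Hilbert C⋆-module. -/
noncomputable instance : HilbertModule B (Completion V) where
  rsmul := complRsmul
  rsmul_mul x b c := by
    change (rsmulL (b * c)).completion x = (rsmulL c).completion ((rsmulL b).completion x)
    refine Completion.induction_on x (isClosed_eq (rsmulL (b * c)).completion.continuous
      ((rsmulL c).completion.continuous.comp (rsmulL b).completion.continuous)) fun a => ?_
    rw [ContinuousLinearMap.completion_apply_coe, ContinuousLinearMap.completion_apply_coe,
      ContinuousLinearMap.completion_apply_coe, rsmulL_apply, rsmul_mul]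
    rfl
  form := LinearMap.mk₂'ₛₗ (starRingEnd ℂ) (RingHom.id ℂ) (complForm B)
    (fun x y z => by
      rw [← star_complForm, complForm_add_right, star_add, star_complForm, star_complForm])
    (fun c x y => by
      rw [← star_complForm, complForm_smul_right, star_smul, star_complForm]; rfl)
    complForm_add_right complForm_smul_right
  form_rsmul x y b := complForm_rsmul x y b
  star_form x y := star_complForm x y
  form_self_nonneg x := complForm_self_nonneg x
  norm_sq_eq x := norm_sq_complForm x

lemma form_coe (x y : V) : form (x : Completion V) (y : Completion V) = (form x y : B) :=
  complForm_coe x y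

lemma continuous_form' {X : Type*} [TopologicalSpace X] {f g : X → Completion V}
    (hf : Continuous f) (hg : Continuous g) : Continuous fun x => (form (f x) (g x) : B) :=
  continuous_complForm' B hf hg

lemma rsmul_coe (x : V) (b : B) :
    rsmul (B := B) (x : Completion V) b = ((rsmul x b : V) : Completion V) :=
  ContinuousLinearMap.completion_apply_coe _ _

end Completion

end PreHilbertModule

/-- A `⋆`-homomorphism from `A` into the algebra of adjointable operators on the (semi-)inner
product `B`-module `V`: the adjoint of the operator `x ↦ a x` is `x ↦ star a x`. -/
structure StarAction (A B V : Type*) [NonUnitalCStarAlgebra A] [NonUnitalCStarAlgebra B]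
    [AddCommGroup V] [Module ℂ V] [PreHilbertModule B V] where
  act : A →ₙₐ[ℂ] Module.End ℂ V
  form_act (a : A) (x y : V) :
    PreHilbertModule.form (B := B) (act a x) y = PreHilbertModule.form x (act (star a) y)

namespace StarAction

open PreHilbertModule

variable {A B V : Type*} [NonUnitalCStarAlgebra A] [NonUnitalCStarAlgebra B]
    [AddCommGroup V] [Module ℂ V] [PreHilbertModule B V]

lemma norm_act_le (L : StarAction A B V) (a : A) (x : V) :
    √‖form (B := B) (L.act a x) (L.act a x)‖ ≤ ‖a‖ * √‖form (B := B) x x‖ := by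
  let := CStarAlgebra.spectralOrder B
  have := CStarAlgebra.spectralOrderedRing B
  let := CStarAlgebra.spectralOrder (Unitization ℂ A)
  have := CStarAlgebra.spectralOrderedRing (Unitization ℂ A)
  -- `‖a‖² - a⋆ a` is positive in the unitization of `A`
  obtain ⟨c, hc⟩ : ∃ c : Unitization ℂ A,
      algebraMap ℝ (Unitization ℂ A) (‖a‖ ^ 2) - ((star a * a : A) : Unitization ℂ A)
        = star c * c := by
    rw [← CStarAlgebra.nonneg_iff_eq_star_mul_self, sub_nonneg]
    have h := CStarAlgebra.star_mul_le_algebraMap_norm_sq (a := (a : Unitization ℂ A))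
    rwa [Unitization.norm_inr, ← Unitization.inr_star, ← Unitization.inr_mul] at h
  have h1 := congrArg (fun z => z.fst) hc
  have h2 := congrArg (fun z => z.snd) hc
  have e1 : ((‖a‖ ^ 2 : ℝ) : ℂ) = star c.fst * c.fst := by
    have h3 : (algebraMap ℝ (Unitization ℂ A) (‖a‖ ^ 2)
        - ((star a * a : A) : Unitization ℂ A)).fst = ((‖a‖ ^ 2 : ℝ) : ℂ) := by
      rw [sub_eq_add_neg, Unitization.fst_add, Unitization.fst_neg, Unitization.fst_inr,
        Algebra.algebraMap_eq_smul_one, Unitization.fst_smul, Unitization.fst_one]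
      simp
    rw [← h3]
    simpa only [Unitization.fst_mul, Unitization.fst_star] using h1
  have e2 : - (star a * a) = star c.fst • c.snd + c.fst • star c.snd + star c.snd * c.snd := by
    have h3 : (algebraMap ℝ (Unitization ℂ A) (‖a‖ ^ 2)
        - ((star a * a : A) : Unitization ℂ A)).snd = - (star a * a) := by
      rw [sub_eq_add_neg, Unitization.snd_add, Unitization.snd_neg, Unitization.snd_inr,
        Algebra.algebraMap_eq_smul_one, Unitization.snd_smul, Unitization.snd_one]
      simp
    rw [← h3]
    simpa only [Unitization.snd_mul, Unitization.fst_star, Unitization.snd_star] using h2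
  have key : (‖a‖ ^ 2) • (form x x : B) - form (L.act a x) (L.act a x)
      = form (c.fst • x + L.act c.snd x) (c.fst • x + L.act c.snd x) := by
    have e3 : (form x (L.act (- (star a * a)) x) : B) = - form (L.act a x) (L.act a x) := by
      rw [map_neg, map_mul, L.form_act]
      simp
    have e4 : (‖a‖ ^ 2) • (form x x : B) = (star c.fst * c.fst) • form x x := by
      rw [← e1]; exact (Complex.coe_smul _ _).symm
    rw [sub_eq_add_neg, ← e3, e2, e4]
    simp only [map_add, map_mul, map_smul, map_smulₛₗ, LinearMap.add_apply, LinearMap.smul_apply,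
      L.form_act, mul_smul, Module.End.mul_apply, starRingEnd_apply]
    rw [smul_add, smul_comm (star c.fst) c.fst]
    abel
  have hle : (form (L.act a x) (L.act a x) : B) ≤ (‖a‖ ^ 2) • form x x := by
    rw [← sub_nonneg, key]
    exact CStarAlgebra.nonneg_iff_eq_star_mul_self.2 (form_self_nonneg _)
  have hn := CStarAlgebra.norm_le_norm_of_nonneg_of_le
    (CStarAlgebra.nonneg_iff_eq_star_mul_self.2 (form_self_nonneg _)) hle
  rw [norm_smul, Real.norm_of_nonneg (sq_nonneg _)] at hn
  calc _ ≤ √(‖a‖ ^ 2 * ‖form (B := B) x x‖) := Real.sqrt_le_sqrt hn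
    _ = _ := by rw [Real.sqrt_mul (sq_nonneg _), Real.sqrt_sq (norm_nonneg _)]

section Completion

variable {A B V : Type*} [NonUnitalCStarAlgebra A] [NonUnitalCStarAlgebra B]
    [SeminormedAddCommGroup V] [NormedSpace ℂ V] [HilbertModule B V]

lemma norm_act_le' (L : StarAction A B V) (a : A) (x : V) : ‖L.act a x‖ ≤ ‖a‖ * ‖x‖ := by
  have := L.norm_act_le a x
  rwa [← HilbertModule.norm_sq_eq, ← HilbertModule.norm_sq_eq, Real.sqrt_sq (norm_nonneg _),
    Real.sqrt_sq (norm_nonneg _)] at this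

/-- The operator by which `a` acts, as a continuous map. -/
noncomputable def actL (L : StarAction A B V) (a : A) : V →L[ℂ] V :=
  LinearMap.mkContinuous (L.act a) ‖a‖ fun x => L.norm_act_le' a x

lemma actL_apply (L : StarAction A B V) (a : A) (x : V) :
    L.actL a x = L.act a x := rfl

open UniformSpace UniformSpace.Completion

/-- The extension of a left action to the completion. -/
noncomputable def compl (L : StarAction A B V) : StarAction A B (Completion V) where
  act :=
    { toFun := fun a => ((L.actL a).completion : Completion V →ₗ[ℂ] Completion V)
      map_smul' := fun c a => by
        refine LinearMap.ext fun x => ?_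
        refine Completion.induction_on x (isClosed_eq (by fun_prop) ?_) fun y => ?_
        · exact (L.actL a).completion.continuous.const_smul c
        · simp only [ContinuousLinearMap.coe_coe, ContinuousLinearMap.completion_apply_coe,
            LinearMap.smul_apply, actL_apply, map_smul, MonoidHom.id_apply, ← coe_smul]
      map_zero' := by
        refine LinearMap.ext fun x => ?_
        refine Completion.induction_on x (isClosed_eq (by fun_prop) ?_) fun y => ?_
        · exact continuous_const
        · simp only [ContinuousLinearMap.coe_coe, ContinuousLinearMap.completion_apply_coe,
            LinearMap.zero_apply, actL_apply, map_zero]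
          exact coe_zero
      map_add' := fun a b => by
        refine LinearMap.ext fun x => ?_
        refine Completion.induction_on x (isClosed_eq (by fun_prop) ?_) fun y => ?_
        · exact (L.actL a).completion.continuous.add (L.actL b).completion.continuous
        · simp only [ContinuousLinearMap.coe_coe, ContinuousLinearMap.completion_apply_coe,
            LinearMap.add_apply, actL_apply, map_add, ← coe_add]
      map_mul' := fun a b => by
        refine LinearMap.ext fun x => ?_
        refine Completion.induction_on x (isClosed_eq (by fun_prop) ?_) fun y => ?_
        · exact (L.actL a).completion.continuous.comp (L.actL b).completion.continuous
        · simp only [ContinuousLinearMap.coe_coe, ContinuousLinearMap.completion_apply_coe,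
            Module.End.mul_apply, actL_apply, map_mul] }
  form_act a x y := by
    refine Completion.induction_on₂ x y (isClosed_eq (continuous_form' ?_ ?_)
      (continuous_form' ?_ ?_)) fun x y => ?_
    · exact (L.actL a).completion.continuous.comp continuous_fst
    · fun_prop
    · fun_prop
    · exact (L.actL (star a)).completion.continuous.comp continuous_snd
    · change form ((L.actL a).completion x) (y : Completion V)
        = form (x : Completion V) ((L.actL (star a)).completion y)
      rw [ContinuousLinearMap.completion_apply_coe, ContinuousLinearMap.completion_apply_coe,
        form_coe, form_coe]
      exact L.form_act a x y

lemma compl_act_coe (L : StarAction A B V) (a : A) (x : V) :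
    L.compl.act a (x : Completion V) = ((L.actL a x : V) : Completion V) :=
  ContinuousLinearMap.completion_apply_coe _ _

end Completion

end StarAction

/-- A left action is nondegenerate if the elements `a x` span a dense subspace. -/
def StarAction.Nondegenerate {A B E : Type*} [NonUnitalCStarAlgebra A] [NonUnitalCStarAlgebra B]
    [SeminormedAddCommGroup E] [NormedSpace ℂ E] [HilbertModule B E] (L : StarAction A B E) :
    Prop :=
  Dense (Submodule.span ℂ {z : E | ∃ a x, L.act a x = z} : Set E)

/-- An `A`-`B` Hilbert bimodule: a Hilbert C⋆-module over `B` with a nondegenerate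
`⋆`-homomorphism of `A` into its adjointable operators. -/
structure HilbertBimodule (A B : Type u) [NonUnitalCStarAlgebra A]
    [NonUnitalCStarAlgebra B] where
  carrier : Type u
  [normedAddCommGroup : NormedAddCommGroup carrier]
  [normedSpace : NormedSpace ℂ carrier]
  [completeSpace : CompleteSpace carrier]
  [hilbertModule : HilbertModule B carrier]
  left : StarAction A B carrier
  nondegenerate : left.Nondegenerate

namespace HilbertBimodule

open PreHilbertModule

attribute [instance] normedAddCommGroup normedSpace completeSpace hilbertModule

section Category

variable {A B : Type u} [NonUnitalCStarAlgebra A] [NonUnitalCStarAlgebra B]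

/-- An arrow between `A`-`B` Hilbert bimodules: an adjointable `A`-linear map. -/
@[ext]
structure Hom (E F : HilbertBimodule A B) where
  toLin : E.carrier →ₗ[ℂ] F.carrier
  adjointable : ∃ S : F.carrier → E.carrier,
    ∀ x y, form (B := B) (toLin x) y = form x (S y)
  map_act (a : A) (x : E.carrier) : toLin (E.left.act a x) = F.left.act a (toLin x)

/-- The category of `A`-`B` Hilbert bimodules. -/
instance : Category (HilbertBimodule A B) where
  Hom E F := Hom E F
  id E := ⟨LinearMap.id, ⟨id, fun _ _ => rfl⟩, fun _ _ => rfl⟩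
  comp f g := ⟨g.toLin ∘ₗ f.toLin, by
      obtain ⟨S, hS⟩ := f.adjointable
      obtain ⟨T, hT⟩ := g.adjointable
      exact ⟨S ∘ T, fun x y => by simp [hS, hT]⟩,
    fun a x => by simp [f.map_act, g.map_act]⟩

end Category

section Tensor

variable {A B C : Type u} [NonUnitalCStarAlgebra A] [NonUnitalCStarAlgebra B]
  [NonUnitalCStarAlgebra C] (E : HilbertBimodule A B) (F : HilbertBimodule B C)

/-- The algebraic tensor product over `ℂ` underlying the interior tensor product. -/
def AlgTensor : Type u := E.carrier ⊗[ℂ] F.carrier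

noncomputable instance : AddCommGroup (AlgTensor E F) :=
  inferInstanceAs (AddCommGroup (E.carrier ⊗[ℂ] F.carrier))

noncomputable instance : Module ℂ (AlgTensor E F) :=
  inferInstanceAs (Module ℂ (E.carrier ⊗[ℂ] F.carrier))

/-- The semi-inner product `⟨x ⊗ y, x' ⊗ y'⟩ = ⟨y, ⟨x, x'⟩ y'⟩` on the algebraic tensor product. -/
noncomputable def tensorForm :
    E.carrier ⊗[ℂ] F.carrier →ₗ⋆[ℂ] E.carrier ⊗[ℂ] F.carrier →ₗ[ℂ] C :=
  TensorProduct.lift <| LinearMap.mk₂'ₛₗ (starRingEnd ℂ) (starRingEnd ℂ)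
    (fun x y => TensorProduct.lift <| LinearMap.mk₂ ℂ
      (fun x' y' => form (B := C) y (F.left.act (form (B := B) x x') y'))
      (fun _ _ _ => by simp) (fun _ _ _ => by simp) (fun _ _ _ => by simp) (fun _ _ _ => by simp))
    (fun _ _ _ => TensorProduct.ext' fun _ _ => by simp)
    (fun _ _ _ => TensorProduct.ext' fun _ _ => by simp)
    (fun _ _ _ => TensorProduct.ext' fun _ _ => by simp)
    (fun _ _ _ => TensorProduct.ext' fun _ _ => by simp)

lemma tensorForm_tmul (x x' : E.carrier) (y y' : F.carrier) :
    tensorForm E F (x ⊗ₜ y) (x' ⊗ₜ y') = form (B := C) y (F.left.act (form (B := B) x x') y') :=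
  rfl

/-- The right action `(x ⊗ y) c = x ⊗ (y c)`. -/
noncomputable def tensorRsmul :
    E.carrier ⊗[ℂ] F.carrier →ₗ[ℂ] C →ₗ[ℂ] E.carrier ⊗[ℂ] F.carrier :=
  (LinearMap.lTensorHom E.carrier ∘ₗ (rsmul (B := C) (V := F.carrier)).flip).flip

lemma tensorRsmul_tmul (x : E.carrier) (y : F.carrier) (c : C) :
    tensorRsmul E F (x ⊗ₜ y) c = x ⊗ₜ rsmul y c := rfl

lemma tensorForm_self_nonneg (t : E.carrier ⊗[ℂ] F.carrier) :
    ∃ c : C, tensorForm E F t t = star c * c := by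
  let := CStarAlgebra.spectralOrder C
  have := CStarAlgebra.spectralOrderedRing C
  rw [← CStarAlgebra.nonneg_iff_eq_star_mul_self]
  obtain ⟨S, rfl⟩ := TensorProduct.exists_finset t
  obtain ⟨Q, hQ⟩ := exists_gram (B := B) fun p : S => p.1.1
  have h : tensorForm E F (∑ p ∈ S, p.1 ⊗ₜ p.2) (∑ p ∈ S, p.1 ⊗ₜ p.2)
      = ∑ k : S, form (B := C) (∑ p : S, F.left.act (Q k p) p.1.2)
          (∑ p : S, F.left.act (Q k p) p.1.2) := by
    rw [← Finset.sum_coe_sort S]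
    simp only [map_sum, LinearMap.sum_apply, tensorForm_tmul, hQ, map_mul, Module.End.mul_apply,
      F.left.form_act]
    rw [Finset.sum_congr rfl fun p _ => Finset.sum_comm, Finset.sum_comm]
  rw [h]
  exact Finset.sum_nonneg fun k _ =>
    CStarAlgebra.nonneg_iff_eq_star_mul_self.2 (form_self_nonneg _)

lemma tensorRsmul_mul (t : E.carrier ⊗[ℂ] F.carrier) (b c : C) :
    tensorRsmul E F t (b * c) = tensorRsmul E F (tensorRsmul E F t b) c := by
  refine TensorProduct.induction_on t (by simp) (fun x y => ?_) fun s t hs ht => ?_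
  · simp only [tensorRsmul_tmul, rsmul_mul]
  · simp only [map_add, LinearMap.add_apply, hs, ht]

lemma tensorForm_rsmul (s t : E.carrier ⊗[ℂ] F.carrier) (c : C) :
    tensorForm E F s (tensorRsmul E F t c) = tensorForm E F s t * c := by
  refine TensorProduct.induction_on t (by simp) (fun x y => ?_) fun t t' ht ht' => ?_
  · refine TensorProduct.induction_on s (by simp) (fun x' y' => ?_) fun s s' hs hs' => ?_
    · rw [tensorRsmul_tmul, tensorForm_tmul, tensorForm_tmul, ← star_star (form x' x : B),
        ← F.left.form_act, ← F.left.form_act, form_rsmul]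
    · simp only [map_add, LinearMap.add_apply, hs, hs', add_mul]
  · simp only [map_add, LinearMap.add_apply, ht, ht', add_mul]

lemma star_tensorForm (s t : E.carrier ⊗[ℂ] F.carrier) :
    star (tensorForm E F s t) = tensorForm E F t s := by
  refine TensorProduct.induction_on t (by simp) (fun x y => ?_) fun t t' ht ht' => ?_
  · refine TensorProduct.induction_on s (by simp) (fun x' y' => ?_) fun s s' hs hs' => ?_
    · rw [tensorForm_tmul, tensorForm_tmul, star_form, F.left.form_act, star_form]
    · simp only [map_add, LinearMap.add_apply, star_add, hs, hs']
  · simp only [map_add, LinearMap.add_apply, star_add, ht, ht']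

noncomputable instance : PreHilbertModule C (AlgTensor E F) where
  rsmul := tensorRsmul E F
  rsmul_mul := tensorRsmul_mul E F
  form := tensorForm E F
  form_rsmul := tensorForm_rsmul E F
  star_form := star_tensorForm E F
  form_self_nonneg := tensorForm_self_nonneg E F

/-- The left action `a (x ⊗ y) = (a x) ⊗ y`. -/
noncomputable def tensorAct : StarAction A C (AlgTensor E F) where
  act :=
    { toFun := fun a => LinearMap.rTensor F.carrier (E.left.act a)
      map_smul' := fun c a => by rw [map_smul, LinearMap.rTensor_smul]; rfl
      map_zero' := by rw [map_zero, LinearMap.rTensor_zero]; rfl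
      map_add' := fun a b => by rw [map_add, LinearMap.rTensor_add]; rfl
      map_mul' := fun a b => by rw [map_mul, LinearMap.rTensor_mul]; rfl }
  form_act a s t := by
    change tensorForm E F (LinearMap.rTensor F.carrier (E.left.act a) s) t
      = tensorForm E F s (LinearMap.rTensor F.carrier (E.left.act (star a)) t)
    refine TensorProduct.induction_on t (by simp) (fun x y => ?_)
      fun t t' ht ht' => ?_
    · refine TensorProduct.induction_on s (by simp) (fun x' y' => ?_) fun s s' hs hs' => ?_
      · rw [LinearMap.rTensor_tmul, LinearMap.rTensor_tmul, tensorForm_tmul, tensorForm_tmul,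
          E.left.form_act]
      · simp only [map_add, LinearMap.add_apply, hs, hs']
    · simp only [map_add, ht, ht']

/-- The elementary tensor `x ⊗ y`, in the seminormed algebraic tensor product. -/
noncomputable def preTmul (x : E.carrier) (y : F.carrier) : Pre C (AlgTensor E F) :=
  (x ⊗ₜ[ℂ] y : E.carrier ⊗[ℂ] F.carrier)

/-- The left action on the seminormed algebraic tensor product. -/
noncomputable def preAct : StarAction A C (Pre C (AlgTensor E F)) where
  act := (tensorAct E F).act
  form_act := (tensorAct E F).form_act

lemma norm_preTmul_le (x : E.carrier) (y : F.carrier) : ‖preTmul E F x y‖ ≤ ‖y‖ * ‖x‖ := by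
  refine abs_le_of_sq_le_sq' ?_ (by positivity) |>.2
  rw [Pre.norm_sq]
  change ‖form (B := C) y (F.left.act (form (B := B) x x) y)‖ ≤ _
  refine (norm_form_le_mul _ _).trans ?_
  have h := F.left.norm_act_le' (form (B := B) x x) y
  rw [← HilbertModule.norm_sq_eq] at h
  calc ‖y‖ * ‖F.left.act (form (B := B) x x) y‖ ≤ ‖y‖ * (‖x‖ ^ 2 * ‖y‖) := by gcongr
    _ = (‖y‖ * ‖x‖) ^ 2 := by ring

/-- The elementary tensor `x ⊗ y` as a continuous linear function of `x`. -/
noncomputable def preTmulL (y : F.carrier) : E.carrier →L[ℂ] Pre C (AlgTensor E F) :=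
  LinearMap.mkContinuous
    { toFun := fun x => preTmul E F x y
      map_add' := fun x x' => TensorProduct.add_tmul x x' y
      map_smul' := fun c x => (TensorProduct.smul_tmul' c x y).symm }
    ‖y‖ fun x => norm_preTmul_le E F x y

lemma tensor_nondegenerate : (preAct E F).compl.Nondegenerate := by
  set S : Submodule ℂ (UniformSpace.Completion (Pre C (AlgTensor E F))) :=
    Submodule.span ℂ {z | ∃ a x, (preAct E F).compl.act a x = z} with hS
  have h1 (x : E.carrier) (y : F.carrier) :
      (preTmul E F x y : UniformSpace.Completion (Pre C (AlgTensor E F)))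
        ∈ S.topologicalClosure := by
    let f : E.carrier →L[ℂ] UniformSpace.Completion (Pre C (AlgTensor E F)) :=
      UniformSpace.Completion.toComplL.comp (preTmulL E F y)
    have hf (x : E.carrier) : f x = preTmul E F x y := rfl
    have h2 : Submodule.span ℂ {z : E.carrier | ∃ a x, E.left.act a x = z}
        ≤ S.topologicalClosure.comap (f : E.carrier →ₗ[ℂ] _) := by
      rw [Submodule.span_le]
      rintro _ ⟨a, x, rfl⟩
      refine S.le_topologicalClosure (Submodule.subset_span ⟨a, preTmul E F x y, ?_⟩)
      exact (preAct E F).compl_act_coe a (preTmul E F x y)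
    have h3 : IsClosed (f ⁻¹' (S.topologicalClosure : Set _)) :=
      S.isClosed_topologicalClosure.preimage f.continuous
    exact closure_minimal h2 h3 (E.nondegenerate x)
  have h4 (t : Pre C (AlgTensor E F)) :
      (t : UniformSpace.Completion (Pre C (AlgTensor E F))) ∈ S.topologicalClosure := by
    let W : Submodule ℂ (Pre C (AlgTensor E F)) := S.topologicalClosure.comap
      (UniformSpace.Completion.toComplL : Pre C (AlgTensor E F) →L[ℂ] _).toLinearMap
    change t ∈ W
    exact TensorProduct.induction_on (motive := fun t : E.carrier ⊗[ℂ] F.carrier =>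
      (t : AlgTensor E F) ∈ (W : Set (Pre C (AlgTensor E F)))) t (zero_mem W) h1
      fun s t hs ht => add_mem (S := Submodule ℂ (Pre C (AlgTensor E F))) hs ht
  intro z
  exact UniformSpace.Completion.induction_on z S.isClosed_topologicalClosure h4

/-- The interior tensor product of Hilbert bimodules: the Hausdorff completion of the algebraic
tensor product for the inner product `⟨x ⊗ y, x' ⊗ y'⟩ = ⟨y, ⟨x, x'⟩ y'⟩`, with
`a (x ⊗ y) c = (a x) ⊗ (y c)`. -/
noncomputable def tensor : HilbertBimodule A C where
  carrier := UniformSpace.Completion (Pre C (AlgTensor E F))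
  left := (preAct E F).compl
  nondegenerate := tensor_nondegenerate E F

end Tensor

section Unit

variable (B : Type u) [NonUnitalCStarAlgebra B]

/-- A C⋆-algebra as a Hilbert C⋆-module over itself, with `⟨a, b⟩ = star a * b`. -/
@[reducible]
noncomputable def selfHilbertModule : HilbertModule B B where
  rsmul := LinearMap.mul ℂ B
  rsmul_mul a b c := (mul_assoc a b c).symm
  form := LinearMap.mk₂'ₛₗ (starRingEnd ℂ) (RingHom.id ℂ) (fun a b => star a * b)
    (fun _ _ _ => by simp [add_mul]) (fun _ _ _ => by simp [smul_mul_assoc])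
    (fun _ _ _ => mul_add _ _ _) (fun _ _ _ => mul_smul_comm _ _ _)
  form_rsmul a b c := (mul_assoc (star a) b c).symm
  star_form a b := by simp
  form_self_nonneg a := ⟨a, rfl⟩
  norm_sq_eq a := by
    rw [sq]; exact (CStarRing.norm_star_mul_self).symm

/-- The unit arrow: `B` as a Hilbert bimodule over itself, by left and right multiplication. -/
noncomputable def unit : HilbertBimodule B B :=
  letI := selfHilbertModule B
  { carrier := B
    left :=
      { act := NonUnitalAlgHom.lmul ℂ B
        form_act := fun a x y => by
          change star (a * x) * y = star x * (star a * y)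
          rw [star_mul, mul_assoc] }
    nondegenerate := by
      let := CStarAlgebra.spectralOrder B
      have := CStarAlgebra.spectralOrderedRing B
      intro b
      refine mem_closure_of_tendsto
        ((CStarAlgebra.increasingApproximateUnit B).tendsto_mul_right b)
        (Filter.Eventually.of_forall fun a => Submodule.subset_span ⟨a, b, rfl⟩) }

end Unit

end HilbertBimodule

/-- Isomorphism of objects in the bicategory of C⋆-algebras and Hilbert bimodules: there are arrows
in both directions whose two composites are isomorphic to the unit arrows. -/
def IsomorphicInCStar (A B : Type u) [NonUnitalCStarAlgebra A] [NonUnitalCStarAlgebra B] : Prop :=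
  ∃ (E : HilbertBimodule A B) (F : HilbertBimodule B A),
    Nonempty (E.tensor F ≅ HilbertBimodule.unit A) ∧
    Nonempty (F.tensor E ≅ HilbertBimodule.unit B)

/-- A nondegenerate representation of a C⋆-algebra on a complex Hilbert space. -/
structure CStarRep (A : Type u) [NonUnitalCStarAlgebra A] where
  space : Type u
  [normedAddCommGroup : NormedAddCommGroup space]
  [innerProductSpace : InnerProductSpace ℂ space]
  [completeSpace : CompleteSpace space]
  π : A →⋆ₙₐ[ℂ] (space →L[ℂ] space)
  nondegenerate : Dense (Submodule.span ℂ {z : space | ∃ a x, π a x = z} : Set space)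

namespace CStarRep

attribute [instance] normedAddCommGroup innerProductSpace completeSpace

variable {A : Type u} [NonUnitalCStarAlgebra A]

/-- A bounded linear intertwiner. -/
@[ext]
structure Hom (H K : CStarRep A) where
  toCLM : H.space →L[ℂ] K.space
  comm (a : A) : toCLM ∘L H.π a = K.π a ∘L toCLM

/-- The representation category of `A`. -/
instance : Category (CStarRep A) where
  Hom H K := Hom H K
  id H := ⟨ContinuousLinearMap.id ℂ H.space, fun _ => rfl⟩
  comp S T := ⟨T.toCLM ∘L S.toCLM, fun a => by
    rw [ContinuousLinearMap.comp_assoc, S.comm, ← ContinuousLinearMap.comp_assoc, T.comm,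
      ContinuousLinearMap.comp_assoc]⟩

variable {H K L : CStarRep A}

@[ext]
lemma hom_ext {S T : H ⟶ K} (h : S.toCLM = T.toCLM) : S = T := Hom.ext h

@[simp] lemma id_toCLM : Hom.toCLM (𝟙 H) = ContinuousLinearMap.id ℂ H.space := rfl

@[simp] lemma comp_toCLM (S : H ⟶ K) (T : K ⟶ L) : (S ≫ T).toCLM = T.toCLM ∘L S.toCLM := rfl

/-- Intertwiners as a linear subspace of the bounded operators. -/
def intertwiners (H K : CStarRep A) : Submodule ℂ (H.space →L[ℂ] K.space) where
  carrier := {T | ∀ a, T ∘L H.π a = K.π a ∘L T}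
  add_mem' hS hT a := by
    rw [ContinuousLinearMap.add_comp, ContinuousLinearMap.comp_add, hS a, hT a]
  zero_mem' a := by simp
  smul_mem' c T hT a := by
    rw [ContinuousLinearMap.smul_comp, ContinuousLinearMap.comp_smul, hT a]

/-- Arrows are the elements of the space of intertwiners. -/
def homEquiv (H K : CStarRep A) : (H ⟶ K) ≃ intertwiners H K where
  toFun T := ⟨T.toCLM, T.comm⟩
  invFun T := ⟨T.1, T.2⟩
  left_inv _ := rfl
  right_inv _ := rfl

noncomputable instance : AddCommGroup (H ⟶ K) := (homEquiv H K).addCommGroup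

noncomputable instance : Module ℂ (H ⟶ K) := (homEquiv H K).module ℂ

@[simp] lemma add_toCLM (S T : H ⟶ K) : (S + T).toCLM = S.toCLM + T.toCLM := rfl

@[simp] lemma smul_toCLM (c : ℂ) (T : H ⟶ K) : (c • T).toCLM = c • T.toCLM := rfl

noncomputable instance : Preadditive (CStarRep A) where
  add_comp _ _ _ S S' T := by ext1; simp [ContinuousLinearMap.comp_add]
  comp_add _ _ _ S T T' := by ext1; simp [ContinuousLinearMap.add_comp]

noncomputable instance : CategoryTheory.Linear ℂ (CStarRep A) where
  smul_comp _ _ _ c S T := by ext1; simp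
  comp_smul _ _ _ S c T := by ext1; simp

/-- The Hilbert space adjoint of an intertwiner. -/
noncomputable def adj (T : H ⟶ K) : K ⟶ H :=
  ⟨ContinuousLinearMap.adjoint T.toCLM, fun a => by
    have h := congrArg ContinuousLinearMap.adjoint (T.comm (star a))
    rw [ContinuousLinearMap.adjoint_comp, ContinuousLinearMap.adjoint_comp,
      ← ContinuousLinearMap.star_eq_adjoint, ← ContinuousLinearMap.star_eq_adjoint,
      map_star, map_star, star_star, star_star] at h
    exact h.symm⟩

end CStarRep

/-! A bimodule `E` from `A` to `B` carries a representation `K` of `B` to a representation of `A` on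
the completion of `E ⊗ K` in the inner product `⟨x ⊗ k, x' ⊗ k'⟩ = ⟨k, ⟨x, x'⟩ k'⟩`. This is Rieffel
induction, and it is functorial through `T ↦ 1 ⊗ T`, which is linear and compatible with adjoints
(`indFunctor`, `indFunctor_map_adj`). Positivity of the inner product and boundedness of `1 ⊗ T`
both come from writing a Gram matrix as `star Q * Q` (`exists_indForm_eq_sum`).

Inducing along `F` and then along `E` amounts to inducing along the interior tensor product: `(x ⊗
y, h) ↦ x ⊗ (y ⊗ h)` preserves inner products and has dense span (`inner_assoc`,
`dense_span_assoc`). Inducing along the unit bimodule changes nothing, since `a ⊗ h ↦ a h`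
identifies `A ⊗ H` with `H` when `H` is nondegenerate. So an isomorphism from the tensor product of
`E` and `F` to the unit makes the composite of the two inductions naturally isomorphic to the
identity (`nonempty_id_iso_ind_comp_ind`). Applied to both composites, this makes induction along
`F` an equivalence with quasi-inverse induction along `E`.

The given isomorphism `φ` need not be unitary. Its inverse `ρ` and its adjoint `σ` are therefore
both used: each yields a bounded map from `H` to the doubly induced space, and the adjoint of the
map from `σ` inverts the map from `ρ`. -/

namespace HilbertBimodule

open PreHilbertModule

/-! ### Rieffel induction of representations along a Hilbert bimodule. -/

section Induction

variable {A B : Type u} [NonUnitalCStarAlgebra A] [NonUnitalCStarAlgebra B]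
  (E : HilbertBimodule A B) (K L : CStarRep B)

lemma _root_.CStarRep.inner_π_left (b : B) (x y : K.space) :
    ⟪K.π b x, y⟫_ℂ = ⟪x, K.π (star b) y⟫_ℂ := by
  rw [map_star, ContinuousLinearMap.star_eq_adjoint, ContinuousLinearMap.adjoint_inner_right]

lemma _root_.CStarRep.π_mul_apply (b c : B) (x : K.space) : K.π (b * c) x = K.π b (K.π c x) := by
  rw [map_mul]; rfl

variable {K L} in
lemma _root_.CStarRep.hom_comm (T : K ⟶ L) (b : B) (x : K.space) :
    T.toCLM (K.π b x) = L.π b (T.toCLM x) :=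
  DFunLike.congr_fun (T.comm b) x

/-- The semi-inner product `⟨x ⊗ k, x' ⊗ k'⟩ = ⟨k, ⟨x, x'⟩ k'⟩` on the algebraic tensor product of
a Hilbert bimodule and the space of a representation. -/
noncomputable def indForm :
    E.carrier ⊗[ℂ] K.space →ₗ⋆[ℂ] E.carrier ⊗[ℂ] K.space →ₗ[ℂ] ℂ :=
  TensorProduct.lift <| LinearMap.mk₂'ₛₗ (starRingEnd ℂ) (starRingEnd ℂ)
    (fun x y => TensorProduct.lift <| LinearMap.mk₂ ℂ
      (fun x' y' => ⟪y, K.π (form (B := B) x x') y'⟫_ℂ)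
      (fun _ _ _ => by simp) (fun _ _ _ => by simp) (fun _ _ _ => by simp) (fun _ _ _ => by simp))
    (fun _ _ _ => TensorProduct.ext' fun _ _ => by simp)
    (fun _ _ _ => TensorProduct.ext' fun _ _ => by simp)
    (fun _ _ _ => TensorProduct.ext' fun _ _ => by simp)
    (fun _ _ _ => TensorProduct.ext' fun _ _ => by simp [mul_comm])

lemma indForm_tmul (x x' : E.carrier) (y y' : K.space) :
    indForm E K (x ⊗ₜ y) (x' ⊗ₜ y') = ⟪y, K.π (form (B := B) x x') y'⟫_ℂ :=
  rfl

/-- If `t = ∑ xᵢ ⊗ kᵢ` and the Gram matrix of the `xᵢ` is `star Q * Q`, then `w k = ∑ᵢ Q k i kᵢ`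
works. An intertwiner commutes with the entries of `Q`, so one family `w` serves every `T`: the case
`T = 𝟙` gives positivity of the form, and general `T` gives the bound on `1 ⊗ T`. -/
lemma exists_indForm_eq_sum (t : E.carrier ⊗[ℂ] K.space) :
    ∃ (ι : Type u) (_ : Fintype ι) (w : ι → K.space), ∀ (L : CStarRep B) (T : K ⟶ L),
      indForm E L (LinearMap.lTensor E.carrier (T.toCLM : K.space →ₗ[ℂ] L.space) t)
        (LinearMap.lTensor E.carrier (T.toCLM : K.space →ₗ[ℂ] L.space) t)
        = ∑ k, ⟪T.toCLM (w k), T.toCLM (w k)⟫_ℂ := by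
  obtain ⟨S, rfl⟩ := TensorProduct.exists_finset t
  obtain ⟨Q, hQ⟩ := exists_gram (B := B) fun p : S => p.1.1
  refine ⟨S, inferInstance, fun k => ∑ p : S, K.π (Q k p) p.1.2, fun L T => ?_⟩
  rw [← Finset.sum_coe_sort S]
  simp only [map_sum, LinearMap.sum_apply, LinearMap.lTensor_tmul, indForm_tmul, hQ,
    ContinuousLinearMap.coe_coe, sum_inner, inner_sum, CStarRep.hom_comm, CStarRep.inner_π_left,
    CStarRep.π_mul_apply, sum_apply]
  -- Only the order of the triple sum differs: the index of the rows of `Q` has to come outermost.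
  rw [Finset.sum_congr rfl fun p _ => Finset.sum_comm, Finset.sum_comm]

lemma star_indForm (s t : E.carrier ⊗[ℂ] K.space) :
    star (indForm E K s t) = indForm E K t s := by
  refine TensorProduct.induction_on t (by simp) (fun x y => ?_) fun t t' ht ht' => ?_
  · refine TensorProduct.induction_on s (by simp) (fun x' y' => ?_) fun s s' hs hs' => ?_
    · rw [indForm_tmul, indForm_tmul, ← starRingEnd_apply, inner_conj_symm, CStarRep.inner_π_left,
        star_form]
    · simp only [map_add, LinearMap.add_apply, star_add, hs, hs']
  · simp only [map_add, LinearMap.add_apply, star_add, ht, ht']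

/-- The algebraic tensor product underlying an induced representation. -/
def IndAlg : Type u := E.carrier ⊗[ℂ] K.space

noncomputable instance : AddCommGroup (IndAlg E K) :=
  inferInstanceAs (AddCommGroup (E.carrier ⊗[ℂ] K.space))

noncomputable instance : Module ℂ (IndAlg E K) :=
  inferInstanceAs (Module ℂ (E.carrier ⊗[ℂ] K.space))

/-- A semi-inner-product space is the case of coefficient algebra `ℂ`, so the seminorm of `Pre` and
the automatic bound `StarAction.norm_act_le` apply here too. -/
noncomputable instance : PreHilbertModule ℂ (IndAlg E K) where
  rsmul := (LinearMap.lsmul ℂ (IndAlg E K)).flip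
  rsmul_mul x b c := by
    simp only [LinearMap.flip_apply, LinearMap.lsmul_apply]; rw [mul_comm, mul_smul]
  form := indForm E K
  form_rsmul x y c := by
    simp only [LinearMap.flip_apply, LinearMap.lsmul_apply]
    exact (map_smul (indForm E K x) c y).trans (mul_comm _ _)
  star_form := star_indForm E K
  form_self_nonneg t := by
    obtain ⟨ι, _, w, hw⟩ := exists_indForm_eq_sum E K t
    have h := hw K (𝟙 K)
    simp only [CStarRep.id_toCLM, ContinuousLinearMap.coe_id, LinearMap.lTensor_id,
      inner_self_eq_norm_sq_to_K] at h
    have hs : 0 ≤ ∑ k, ‖w k‖ ^ 2 := Finset.sum_nonneg fun k _ => sq_nonneg _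
    refine ⟨(√(∑ k, ‖w k‖ ^ 2) : ℝ), h.trans ?_⟩
    rw [← starRingEnd_apply, Complex.conj_ofReal, ← Complex.ofReal_mul, Real.mul_self_sqrt hs]
    simp

/-- The algebraic tensor product, as a seminormed space. -/
abbrev IndPre : Type u := Pre ℂ (IndAlg E K)

noncomputable instance : InnerProductSpace ℂ (IndPre E K) where
  inner s t := form (B := ℂ) s t
  norm_sq_eq_re_inner t := by
    obtain ⟨c, hc⟩ := form_self_nonneg (B := ℂ) t
    rw [Pre.norm_sq, hc, Complex.star_def, mul_comm, Complex.mul_conj]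
    simp [Complex.normSq_nonneg]
  conj_inner_symm s t := star_form t s
  add_left s t r := by simp
  smul_left s t c := by simp

/-- The canonical map from the algebraic tensor product to its completion. -/
noncomputable def indMap :
    E.carrier ⊗[ℂ] K.space →ₗ[ℂ] UniformSpace.Completion (IndPre E K) :=
  (UniformSpace.Completion.toComplL : IndPre E K →L[ℂ] _).toLinearMap

lemma denseRange_indMap : DenseRange (indMap E K) :=
  UniformSpace.Completion.denseRange_coe (α := IndPre E K)

lemma inner_indMap (s t : E.carrier ⊗[ℂ] K.space) :
    ⟪indMap E K s, indMap E K t⟫_ℂ = indForm E K s t :=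
  UniformSpace.Completion.inner_coe (E := IndPre E K) s t

lemma norm_sq_indMap (t : E.carrier ⊗[ℂ] K.space) :
    ‖indMap E K t‖ ^ 2 = ‖indForm E K t t‖ := by
  rw [← inner_indMap, inner_self_eq_norm_sq_to_K]
  simp

/-- The elementary tensor `x ⊗ k` in the induced representation. -/
noncomputable abbrev indTmul (x : E.carrier) (k : K.space) :
    UniformSpace.Completion (IndPre E K) :=
  indMap E K (x ⊗ₜ k)

lemma inner_indTmul (x x' : E.carrier) (k k' : K.space) :
    ⟪indTmul E K x k, indTmul E K x' k'⟫_ℂ = ⟪k, K.π (form (B := B) x x') k'⟫_ℂ :=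
  inner_indMap E K _ _

variable {E K} in
-- Elementary tensors span a dense subspace, which reduces identities between bounded operators to a
-- check on them.
lemma ind_ext {W : Type*} [NormedAddCommGroup W] [NormedSpace ℂ W]
    {S T : UniformSpace.Completion (IndPre E K) →L[ℂ] W}
    (h : ∀ x k, S (indTmul E K x k) = T (indTmul E K x k)) : S = T := by
  have h1 : S.toLinearMap ∘ₗ indMap E K = T.toLinearMap ∘ₗ indMap E K := TensorProduct.ext' h
  refine ContinuousLinearMap.ext fun z => ?_
  refine (denseRange_indMap E K).induction_on z (isClosed_eq S.continuous T.continuous) fun t => ?_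
  exact DFunLike.congr_fun h1 t

lemma _root_.CStarRep.norm_π_le (b : B) (k : K.space) : ‖K.π b k‖ ≤ ‖b‖ * ‖k‖ :=
  ((K.π b).le_opNorm k).trans
    (mul_le_mul_of_nonneg_right (NonUnitalStarAlgHom.norm_apply_le K.π b) (norm_nonneg _))

lemma norm_indTmul_le (x : E.carrier) (k : K.space) : ‖indTmul E K x k‖ ≤ ‖x‖ * ‖k‖ := by
  refine abs_le_of_sq_le_sq' ?_ (by positivity) |>.2
  rw [norm_sq_indMap, indForm_tmul]
  calc _ ≤ ‖k‖ * ‖K.π (form (B := B) x x) k‖ := norm_inner_le_norm _ _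
    _ ≤ ‖k‖ * (‖form (B := B) x x‖ * ‖k‖) := by gcongr; exact K.norm_π_le _ _
    _ = (‖x‖ * ‖k‖) ^ 2 := by rw [← HilbertModule.norm_sq_eq]; ring

/-- The elementary tensor as a bounded bilinear map. -/
noncomputable def indTmulL :
    E.carrier →L[ℂ] K.space →L[ℂ] UniformSpace.Completion (IndPre E K) :=
  LinearMap.mkContinuous₂ ((TensorProduct.mk ℂ E.carrier K.space).compr₂ (indMap E K)) 1
    fun x k => by rw [one_mul]; exact norm_indTmul_le E K x k

/-- The action of `A` on the algebraic tensor product. -/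
noncomputable def indAct : StarAction A ℂ (IndAlg E K) where
  act :=
    { toFun := fun a => LinearMap.rTensor K.space (E.left.act a)
      map_smul' := fun c a => by rw [map_smul, LinearMap.rTensor_smul]; rfl
      map_zero' := by rw [map_zero, LinearMap.rTensor_zero]; rfl
      map_add' := fun a b => by rw [map_add, LinearMap.rTensor_add]; rfl
      map_mul' := fun a b => by rw [map_mul, LinearMap.rTensor_mul]; rfl }
  form_act a s t := by
    change indForm E K (LinearMap.rTensor K.space (E.left.act a) s) t
      = indForm E K s (LinearMap.rTensor K.space (E.left.act (star a)) t)
    refine TensorProduct.induction_on t (by simp) (fun x y => ?_)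
      fun t t' ht ht' => ?_
    · refine TensorProduct.induction_on s (by simp) (fun x' y' => ?_) fun s s' hs hs' => ?_
      · rw [LinearMap.rTensor_tmul, LinearMap.rTensor_tmul, indForm_tmul, indForm_tmul,
          E.left.form_act]
      · simp only [map_add, LinearMap.add_apply, hs, hs']
    · simp only [map_add, ht, ht']

/-- Positivity of `‖a‖² - star a * a` in the unitization bounds every action by adjointable
operators; here this is used for `indAct`, whose coefficient algebra is `ℂ`. -/
lemma norm_indMap_rTensor_le (a : A) (t : E.carrier ⊗[ℂ] K.space) :
    ‖indMap E K (LinearMap.rTensor K.space (E.left.act a) t)‖ ≤ ‖a‖ * ‖indMap E K t‖ := by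
  have h := (indAct E K).norm_act_le a t
  rw [← Real.sqrt_sq (norm_nonneg (indMap E K t)), norm_sq_indMap,
    ← Real.sqrt_sq (norm_nonneg (indMap E K (LinearMap.rTensor K.space (E.left.act a) t))),
    norm_sq_indMap]
  exact h

/-- The operator `x ⊗ k ↦ a x ⊗ k`. -/
noncomputable def indActL (a : A) :
    UniformSpace.Completion (IndPre E K) →L[ℂ] UniformSpace.Completion (IndPre E K) :=
  (indMap E K ∘ₗ LinearMap.rTensor K.space (E.left.act a)).extendOfNorm (indMap E K)

@[simp]
lemma indActL_tmul (a : A) (x : E.carrier) (k : K.space) :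
    indActL E K a (indTmul E K x k) = indTmul E K (E.left.act a x) k :=
  LinearMap.extendOfNorm_eq (denseRange_indMap E K) ⟨_, norm_indMap_rTensor_le E K a⟩ _

variable {E K L} in
-- Testing against elementary tensors on both sides lets an adjoint be moved across the inner
-- product, where no direct formula for its values is available.
lemma ind_ext_inner {S T : UniformSpace.Completion (IndPre E K) →L[ℂ]
      UniformSpace.Completion (IndPre E L)}
    (h : ∀ x k x' l, ⟪indTmul E L x' l, S (indTmul E K x k)⟫_ℂ
      = ⟪indTmul E L x' l, T (indTmul E K x k)⟫_ℂ) : S = T := by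
  refine ind_ext fun x k => (InnerProductSpace.toDual ℂ _).injective ?_
  refine ind_ext fun x' l => ?_
  rw [InnerProductSpace.toDual_apply_apply, InnerProductSpace.toDual_apply_apply,
    ← inner_conj_symm, h, inner_conj_symm]

/-- The representation of `A` induced from a representation of `B` along a Hilbert bimodule. -/
noncomputable def ind : CStarRep A where
  space := UniformSpace.Completion (IndPre E K)
  π :=
    { toFun := indActL E K
      map_smul' := fun c a => ind_ext fun x k => by
        rw [indActL_tmul, indTmul, map_smul, LinearMap.smul_apply, ← TensorProduct.smul_tmul',
          map_smul]
        exact congrArg (c • ·) (indActL_tmul E K a x k).symm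
      map_zero' := ind_ext fun x k => by simp [indTmul]
      map_add' := fun a b => ind_ext fun x k => by simp [TensorProduct.add_tmul, indTmul]
      map_mul' := fun a b => ind_ext fun x k => by simp
      map_star' := fun a => ind_ext_inner fun x k x' l => by
        rw [ContinuousLinearMap.star_eq_adjoint, ContinuousLinearMap.adjoint_inner_right,
          indActL_tmul, indActL_tmul, inner_indTmul, inner_indTmul, E.left.form_act] }
  nondegenerate := by
    set S : Submodule ℂ (UniformSpace.Completion (IndPre E K)) :=
      Submodule.span ℂ {z | ∃ a x, indActL E K a x = z}
    -- For fixed `k`, the vectors `x` with `x ⊗ k` in the closure form a closed subspace containing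
    -- every `a x'`, hence all of `E` because `E` is nondegenerate.
    have h1 (x : E.carrier) (k : K.space) : indTmul E K x k ∈ S.topologicalClosure := by
      let f := (indTmulL E K).flip k
      have h2 : Submodule.span ℂ {z : E.carrier | ∃ a x, E.left.act a x = z}
          ≤ S.topologicalClosure.comap (f : E.carrier →ₗ[ℂ] _) := by
        rw [Submodule.span_le]
        rintro _ ⟨a, x, rfl⟩
        exact S.le_topologicalClosure
          (Submodule.subset_span ⟨a, indTmul E K x k, indActL_tmul E K a x k⟩)
      exact closure_minimal h2 (S.isClosed_topologicalClosure.preimage f.continuous)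
        (E.nondegenerate x)
    have h3 (t : E.carrier ⊗[ℂ] K.space) : indMap E K t ∈ S.topologicalClosure := by
      refine TensorProduct.induction_on t (by simp) h1 fun s t hs ht => ?_
      rw [map_add]
      exact add_mem hs ht
    intro z
    exact (denseRange_indMap E K).induction_on z S.isClosed_topologicalClosure h3

/-- The elementary tensors of an induced representation, as a bounded bilinear map. -/
noncomputable def tmulL : E.carrier →L[ℂ] K.space →L[ℂ] (E.ind K).space :=
  indTmulL E K

lemma inner_tmulL (x x' : E.carrier) (k k' : K.space) :
    ⟪tmulL E K x k, tmulL E K x' k'⟫_ℂ = ⟪k, K.π (form (B := B) x x') k'⟫_ℂ :=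
  inner_indTmul E K x x' k k'

lemma ind_π_tmulL (a : A) (x : E.carrier) (k : K.space) :
    (E.ind K).π a (tmulL E K x k) = tmulL E K (E.left.act a x) k :=
  indActL_tmul E K a x k

variable {E K} in
lemma mem_of_tmulL_mem {S : Submodule ℂ (E.ind K).space} (hS : IsClosed (S : Set (E.ind K).space))
    (h : ∀ x k, tmulL E K x k ∈ S) (z : (E.ind K).space) : z ∈ S := by
  let f : E.carrier ⊗[ℂ] K.space →ₗ[ℂ] (E.ind K).space := indMap E K
  refine (denseRange_indMap E K).induction_on (p := fun z : (E.ind K).space => z ∈ S) z hS ?_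
  change ∀ t, f t ∈ S
  intro t
  refine TensorProduct.induction_on t (by simp) h fun s t hs ht => ?_
  rw [map_add]
  exact add_mem hs ht

variable {K L}

/-- With the common family `w` of `exists_indForm_eq_sum`, the two squared norms are `∑ ‖T (w k)‖²`
and `∑ ‖w k‖²`, which compare term by term. -/
lemma norm_indMap_lTensor_le (T : K ⟶ L) (t : E.carrier ⊗[ℂ] K.space) :
    ‖indMap E L (LinearMap.lTensor E.carrier (T.toCLM : K.space →ₗ[ℂ] L.space) t)‖
      ≤ ‖T.toCLM‖ * ‖indMap E K t‖ := by
  obtain ⟨ι, _, w, hw⟩ := exists_indForm_eq_sum E K t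
  have h1 : ‖indMap E K t‖ ^ 2 = ∑ k, ‖w k‖ ^ 2 := by
    have h := hw K (𝟙 K)
    simp only [CStarRep.id_toCLM, ContinuousLinearMap.coe_id, LinearMap.lTensor_id,
      ← inner_indMap, inner_self_eq_norm_sq_to_K] at h
    exact_mod_cast h
  have h2 := hw L T
  simp only [← inner_indMap, inner_self_eq_norm_sq_to_K] at h2
  have h3 : ‖indMap E L (LinearMap.lTensor E.carrier (T.toCLM : K.space →ₗ[ℂ] L.space) t)‖ ^ 2
      = ∑ k, ‖T.toCLM (w k)‖ ^ 2 := by exact_mod_cast h2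
  refine abs_le_of_sq_le_sq' ?_ (by positivity) |>.2
  rw [mul_pow, h1, h3, Finset.mul_sum]
  refine Finset.sum_le_sum fun k _ => ?_
  rw [← mul_pow]
  gcongr
  exact T.toCLM.le_opNorm _

/-- The operator `x ⊗ k ↦ x ⊗ T k`. -/
noncomputable def indMapL (T : K ⟶ L) :
    UniformSpace.Completion (IndPre E K) →L[ℂ] UniformSpace.Completion (IndPre E L) :=
  (indMap E L ∘ₗ LinearMap.lTensor E.carrier (T.toCLM : K.space →ₗ[ℂ] L.space)).extendOfNorm
    (indMap E K)

@[simp]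
lemma indMapL_tmul (T : K ⟶ L) (x : E.carrier) (k : K.space) :
    indMapL E T (indTmul E K x k) = indTmul E L x (T.toCLM k) :=
  LinearMap.extendOfNorm_eq (denseRange_indMap E K) ⟨_, norm_indMap_lTensor_le E T⟩ _

/-- The intertwiner `x ⊗ k ↦ x ⊗ T k` of induced representations. -/
noncomputable def indHom (T : K ⟶ L) : E.ind K ⟶ E.ind L :=
  ⟨indMapL E T, fun a => ind_ext fun x k => by
    change indMapL E T (indActL E _ a _) = indActL E _ a (indMapL E T _)
    simp only [indActL_tmul, indMapL_tmul]⟩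

lemma indHom_tmulL (T : K ⟶ L) (x : E.carrier) (k : K.space) :
    (indHom E T).toCLM (tmulL E K x k) = tmulL E L x (T.toCLM k) :=
  indMapL_tmul E T x k

/-- Induction of representations along a Hilbert bimodule. -/
noncomputable def indFunctor : CStarRep B ⥤ CStarRep A where
  obj K := E.ind K
  map T := indHom E T
  map_id K := CStarRep.hom_ext (ind_ext fun x k => indMapL_tmul E (𝟙 K) x k)
  map_comp S T := CStarRep.hom_ext (ind_ext fun x k => by
    change indMapL E (S ≫ T) _ = indMapL E T (indMapL E S _)
    simp only [indMapL_tmul]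
    rfl)

instance : (indFunctor E).Additive where
  map_add {K L S T} := CStarRep.hom_ext (ind_ext fun x k => by
    change indMapL E (S + T) _ = indMapL E S _ + indMapL E T _
    simp only [indMapL_tmul, CStarRep.add_toCLM, _root_.add_apply]
    rw [indTmul, TensorProduct.tmul_add, map_add])

instance : (indFunctor E).Linear ℂ where
  map_smul {K L} T c := CStarRep.hom_ext (ind_ext fun x k => by
    change indMapL E (c • T) _ = c • indMapL E T _
    simp only [indMapL_tmul, CStarRep.smul_toCLM, _root_.smul_apply]
    rw [indTmul, TensorProduct.tmul_smul, map_smul])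

/-- On elementary tensors both sides have matrix coefficient `⟨T l, ⟨x', x⟩ k⟩`, because the adjoint
of `T` is itself an intertwiner and passes through the action of `⟨x', x⟩`. -/
lemma indFunctor_map_adj (T : K ⟶ L) :
    (indFunctor E).map (CStarRep.adj T) = CStarRep.adj ((indFunctor E).map T) :=
  CStarRep.hom_ext (ind_ext_inner fun x k x' l => by
    change ⟪_, indMapL E (CStarRep.adj T) _⟫_ℂ
      = ⟪_, ContinuousLinearMap.adjoint (indMapL E T) _⟫_ℂ
    rw [ContinuousLinearMap.adjoint_inner_right, indMapL_tmul, indMapL_tmul, inner_indTmul,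
      inner_indTmul, ← CStarRep.hom_comm]
    exact ContinuousLinearMap.adjoint_inner_right _ _ _)

end Induction

/-! ### Iterated induction compared with the interior tensor product. -/

section Associator

variable {A B C : Type u} [NonUnitalCStarAlgebra A] [NonUnitalCStarAlgebra B]
  [NonUnitalCStarAlgebra C] (E : HilbertBimodule A B) (F : HilbertBimodule B C) (H K : CStarRep C)

/-- The map `x ⊗ y ↦ (h ↦ x ⊗ (y ⊗ h))` on the algebraic tensor product. -/
noncomputable def assocPre :
    E.carrier ⊗[ℂ] F.carrier →ₗ[ℂ] H.space →L[ℂ] (E.ind (F.ind H)).space :=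
  TensorProduct.lift <| LinearMap.mk₂ ℂ
    (fun x y => (tmulL E (F.ind H) x).comp (tmulL F H y))
    (fun _ _ _ => by rw [map_add]; rfl)
    (fun _ _ _ => by rw [map_smul]; rfl)
    (fun _ _ _ => by rw [map_add, ContinuousLinearMap.comp_add])
    (fun _ _ _ => by rw [map_smul, ContinuousLinearMap.comp_smul])

lemma assocPre_tmul (x : E.carrier) (y : F.carrier) (h : H.space) :
    assocPre E F H (x ⊗ₜ y) h = tmulL E (F.ind H) x (tmulL F H y h) := rfl

/-- Unfolding the induced inner product twice on elementary tensors gives `⟨h, ⟨y, ⟨x, x'⟩ y'⟩ h'⟩`,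
in which the inner product of the interior tensor product appears. -/
lemma inner_assocPre (s t : E.carrier ⊗[ℂ] F.carrier) (h h' : H.space) :
    ⟪assocPre E F H s h, assocPre E F H t h'⟫_ℂ = ⟪h, H.π (tensorForm E F s t) h'⟫_ℂ := by
  refine TensorProduct.induction_on t (by simp) (fun x y => ?_) fun t t' ht ht' => ?_
  · refine TensorProduct.induction_on s (by simp) (fun x' y' => ?_) fun s s' hs hs' => ?_
    · rw [assocPre_tmul, assocPre_tmul, inner_tmulL, ind_π_tmulL, inner_tmulL, tensorForm_tmul]
    · simp only [map_add, LinearMap.add_apply, add_apply, inner_add_left, inner_add_right, hs, hs']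
  · simp only [map_add, add_apply, inner_add_right, ht, ht']

/-- The canonical map from the algebraic to the interior tensor product. -/
noncomputable def tensorMap : E.carrier ⊗[ℂ] F.carrier →ₗ[ℂ] (E.tensor F).carrier :=
  (UniformSpace.Completion.toComplL : Pre C (AlgTensor E F) →L[ℂ] _).toLinearMap

lemma denseRange_tensorMap : DenseRange (tensorMap E F) :=
  UniformSpace.Completion.denseRange_coe (α := Pre C (AlgTensor E F))

lemma form_tensorMap (s t : E.carrier ⊗[ℂ] F.carrier) :
    form (B := C) (tensorMap E F s) (tensorMap E F t) = tensorForm E F s t :=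
  form_coe (V := Pre C (AlgTensor E F)) s t

lemma act_tensorMap (a : A) (t : E.carrier ⊗[ℂ] F.carrier) :
    (E.tensor F).left.act a (tensorMap E F t)
      = tensorMap E F (LinearMap.rTensor F.carrier (E.left.act a) t) :=
  (preAct E F).compl_act_coe a t

lemma norm_assocPre_le (t : E.carrier ⊗[ℂ] F.carrier) :
    ‖assocPre E F H t‖ ≤ 1 * ‖tensorMap E F t‖ := by
  rw [one_mul]
  refine ContinuousLinearMap.opNorm_le_bound _ (norm_nonneg _) fun h => ?_
  refine abs_le_of_sq_le_sq' ?_ (by positivity) |>.2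
  have h1 : ‖assocPre E F H t h‖ ^ 2 = ‖⟪h, H.π (tensorForm E F t t) h⟫_ℂ‖ := by
    rw [← inner_assocPre, inner_self_eq_norm_sq_to_K]
    simp
  rw [h1, mul_pow, HilbertModule.norm_sq_eq (B := C) (tensorMap E F t), form_tensorMap]
  calc _ ≤ ‖h‖ * ‖H.π (tensorForm E F t t) h‖ := norm_inner_le_norm _ _
    _ ≤ ‖h‖ * (‖tensorForm E F t t‖ * ‖h‖) := by gcongr; exact H.norm_π_le _ _
    _ = ‖tensorForm E F t t‖ * ‖h‖ ^ 2 := by ring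

/-- The associativity map `(x ⊗ y, h) ↦ x ⊗ (y ⊗ h)`. -/
noncomputable def assoc :
    (E.tensor F).carrier →L[ℂ] H.space →L[ℂ] (E.ind (F.ind H)).space :=
  (assocPre E F H).extendOfNorm (tensorMap E F)

lemma assoc_tensorMap (t : E.carrier ⊗[ℂ] F.carrier) :
    assoc E F H (tensorMap E F t) = assocPre E F H t :=
  LinearMap.extendOfNorm_eq (denseRange_tensorMap E F) ⟨_, norm_assocPre_le E F H⟩ t

/-- Both sides are continuous in `z` and `z'`, a representation being contractive, so
`inner_assocPre` extends to the completion. -/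
lemma inner_assoc (z z' : (E.tensor F).carrier) (h h' : H.space) :
    ⟪assoc E F H z h, assoc E F H z' h'⟫_ℂ = ⟪h, H.π (form (B := C) z z') h'⟫_ℂ := by
  have hπ : Continuous H.π := by
    refine AddMonoidHomClass.continuous_of_bound H.π 1 fun c => ?_
    rw [one_mul]
    exact NonUnitalStarAlgHom.norm_apply_le H.π c
  have hf : Continuous fun p : (E.tensor F).carrier × (E.tensor F).carrier =>
    form (B := C) p.1 p.2 := continuous_form
  refine (denseRange_tensorMap E F).induction_on₂ (p := fun z z' =>
    ⟪assoc E F H z h, assoc E F H z' h'⟫_ℂ = ⟪h, H.π (form (B := C) z z') h'⟫_ℂ) ?_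
    (fun s t => ?_) z z'
  · refine isClosed_eq (by fun_prop) ?_
    exact continuous_const.inner ((hπ.comp hf).clm_apply continuous_const)
  · rw [assoc_tensorMap, assoc_tensorMap, inner_assocPre, form_tensorMap]

/-- Tensors are taken over `ℂ`, so balancing over `C` is not built in. It holds because the
difference has norm zero: the four inner products in its square are all `⟨c h, ⟨z, z⟩ c h⟩` and
cancel. -/
lemma assoc_rsmul (z : (E.tensor F).carrier) (c : C) (h : H.space) :
    assoc E F H (rsmul z c) h = assoc E F H z (H.π c h) := by
  rw [← sub_eq_zero, ← inner_self_eq_zero (𝕜 := ℂ)]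
  simp only [inner_sub_left, inner_sub_right, inner_assoc, form_rsmul, rsmul_form,
    CStarRep.π_mul_apply, CStarRep.inner_π_left]
  simp

lemma assoc_act (a : A) (z : (E.tensor F).carrier) (h : H.space) :
    assoc E F H ((E.tensor F).left.act a z) h = (E.ind (F.ind H)).π a (assoc E F H z h) := by
  have h1 : Continuous ((E.tensor F).left.act a) := ((E.tensor F).left.actL a).continuous
  refine (denseRange_tensorMap E F).induction_on z (isClosed_eq (by fun_prop) (by fun_prop))
    fun t => ?_
  rw [act_tensorMap, assoc_tensorMap, assoc_tensorMap]
  refine TensorProduct.induction_on t (by simp) (fun x y => ?_) fun s t hs ht => ?_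
  · rw [LinearMap.rTensor_tmul, assocPre_tmul, assocPre_tmul, ind_π_tmulL]
  · simp only [map_add, add_apply, hs, ht]

variable {H K} in
lemma assoc_natural (T : H ⟶ K) (z : (E.tensor F).carrier) (h : H.space) :
    (indHom E (indHom F T)).toCLM (assoc E F H z h)
      = assoc E F K z (T.toCLM h) := by
  refine (denseRange_tensorMap E F).induction_on z
    (isClosed_eq (by fun_prop) (by fun_prop))
    fun t => ?_
  rw [assoc_tensorMap, assoc_tensorMap]
  refine TensorProduct.induction_on t (by simp) (fun x y => ?_) fun s t hs ht => ?_
  · rw [assocPre_tmul, assocPre_tmul, indHom_tmulL, indHom_tmulL]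
  · simp only [map_add, add_apply, hs, ht]

/-- Density is needed at two levels: vectors `y ⊗ h` are total in the inner induced space, and then
vectors `x ⊗ v` are total in the outer one. -/
lemma dense_span_assoc :
    Dense (Submodule.span ℂ {w | ∃ z h, assoc E F H z h = w} :
      Set (E.ind (F.ind H)).space) := by
  set S : Submodule ℂ (E.ind (F.ind H)).space :=
    Submodule.span ℂ {w | ∃ z h, assoc E F H z h = w}
  have h1 (x : E.carrier) (v : (F.ind H).space) :
      v ∈ S.topologicalClosure.comap (tmulL E (F.ind H) x).toLinearMap := by
    refine mem_of_tmulL_mem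
      (S.isClosed_topologicalClosure.preimage (tmulL E (F.ind H) x).continuous) (fun y h => ?_) v
    refine S.le_topologicalClosure (Submodule.subset_span ⟨tensorMap E F (x ⊗ₜ y), h, ?_⟩)
    rw [assoc_tensorMap]
    rfl
  exact fun z => mem_of_tmulL_mem S.isClosed_topologicalClosure h1 z

end Associator

/-! ### Adjointable maps, and the natural isomorphism obtained from an isomorphism with the unit
bimodule. -/

section UnitIso

variable {A B : Type u} [NonUnitalCStarAlgebra A] [NonUnitalCStarAlgebra B]

lemma eq_of_form_eq {E : HilbertBimodule A B} {x y : E.carrier}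
    (h : ∀ z, form (B := B) z x = form z y) : x = y := by
  have h1 : form (B := B) (x - y) (x - y) = 0 := by rw [map_sub, h, sub_self]
  have h2 := HilbertModule.norm_sq_eq (B := B) (x - y)
  rw [h1, norm_zero] at h2
  exact sub_eq_zero.1 (norm_eq_zero.1 (by simpa using h2))

/-- An adjointable map is continuous, by the closed graph theorem. -/
lemma continuous_of_adjoint {E F : HilbertBimodule A B} (f : E.carrier →ₗ[ℂ] F.carrier)
    (g : F.carrier → E.carrier) (h : ∀ x y, form (B := B) (f x) y = form x (g y)) :
    Continuous f := by
  refine f.continuous_of_seq_closed_graph fun u x y hu hfu => ?_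
  refine eq_of_form_eq fun z => ?_
  have hf : Continuous fun p : F.carrier × F.carrier => form (B := B) p.1 p.2 := continuous_form
  have he : Continuous fun p : E.carrier × E.carrier => form (B := B) p.1 p.2 := continuous_form
  have h1 : Filter.Tendsto (fun n => form (B := B) z (f (u n))) Filter.atTop (nhds (form z y)) :=
    ((hf.comp (continuous_const.prodMk continuous_id)).tendsto y).comp hfu
  have h2 : Filter.Tendsto (fun n => form (B := B) (g z) (u n)) Filter.atTop
      (nhds (form (g z) x)) :=
    ((he.comp (continuous_const.prodMk continuous_id)).tendsto x).comp hu
  have h3 (v : E.carrier) : form (B := B) z (f v) = form (g z) v := by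
    rw [← star_form, h, star_form]
  -- The sequence `⟨z, f (u n)⟩ = ⟨g z, u n⟩` converges both to `⟨z, y⟩` and to `⟨g z, x⟩`.
  rw [h3]
  exact tendsto_nhds_unique h1 (by simpa only [Function.comp_def, h3] using h2)

/-- An adjointable map is linear for the right action. -/
lemma map_rsmul_of_adjoint {E F : HilbertBimodule A B} (f : E.carrier →ₗ[ℂ] F.carrier)
    (g : F.carrier → E.carrier) (h : ∀ x y, form (B := B) (f x) y = form x (g y))
    (x : E.carrier) (b : B) : f (rsmul x b) = rsmul (f x) b := by
  refine eq_of_form_eq fun z => ?_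
  have h3 (v : E.carrier) : form (B := B) z (f v) = form (g z) v := by
    rw [← star_form, h, star_form]
  rw [h3, form_rsmul, form_rsmul, h3]

/-- A map which is an adjoint is linear. -/
noncomputable def adjointLin {E F : HilbertBimodule A B} (f : E.carrier →ₗ[ℂ] F.carrier)
    (g : F.carrier → E.carrier) (h : ∀ x y, form (B := B) (f x) y = form x (g y)) :
    F.carrier →ₗ[ℂ] E.carrier where
  toFun := g
  map_add' x y := eq_of_form_eq fun z => by rw [← h, map_add, map_add, h, h]
  map_smul' c x := eq_of_form_eq fun z => by
    rw [← h, map_smul, h, RingHom.id_apply, map_smul]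

variable (E : HilbertBimodule A B) (F : HilbertBimodule B A) (H K : CStarRep A)

/-- The map `a ⊗ h ↦ a h`. -/
noncomputable def repMap : A ⊗[ℂ] H.space →ₗ[ℂ] H.space :=
  TensorProduct.lift <| LinearMap.mk₂ ℂ (fun a h => H.π a h)
    (fun _ _ _ => by simp) (fun _ _ _ => by simp) (fun _ _ _ => by simp) (fun _ _ _ => by simp)

lemma repMap_tmul (a : A) (h : H.space) : repMap H (a ⊗ₜ h) = H.π a h := rfl

lemma denseRange_repMap : DenseRange (repMap H) := by
  refine H.nondegenerate.mono ?_
  rw [← LinearMap.coe_range, SetLike.coe_subset_coe, Submodule.span_le]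
  rintro _ ⟨a, h, rfl⟩
  exact ⟨a ⊗ₜ h, rfl⟩

variable {H} in
-- Nondegeneracy of `H` makes the vectors `a x` total.
lemma rep_ext {W : Type*} [NormedAddCommGroup W] [NormedSpace ℂ W] {S T : H.space →L[ℂ] W}
    (h : ∀ a x, S (H.π a x) = T (H.π a x)) : S = T := by
  have h1 : S.toLinearMap ∘ₗ repMap H = T.toLinearMap ∘ₗ repMap H := TensorProduct.ext' h
  refine ContinuousLinearMap.ext fun z => ?_
  exact (denseRange_repMap H).induction_on z (isClosed_eq S.continuous T.continuous)
    fun t => DFunLike.congr_fun h1 t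

variable (ρ : A →L[ℂ] (E.tensor F).carrier)

/-- The map `a ⊗ h ↦ ρ a ⊗ h`. -/
noncomputable def unitorPre : A ⊗[ℂ] H.space →ₗ[ℂ] (E.ind (F.ind H)).space :=
  TensorProduct.lift <| LinearMap.mk₂ ℂ (fun a h => assoc E F H (ρ a) h)
    (fun _ _ _ => by simp) (fun _ _ _ => by simp) (fun _ _ _ => by simp) (fun _ _ _ => by simp)

lemma unitorPre_tmul (a : A) (h : H.space) :
    unitorPre E F H ρ (a ⊗ₜ h) = assoc E F H (ρ a) h := rfl

variable {ρ} in
-- This bound makes `a h ↦ ρ a ⊗ h` well defined. In a unital algebra one would write `∑ ρ aᵢ ⊗ hᵢ =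
-- ρ 1 ⊗ ∑ aᵢ hᵢ`. In general an approximate unit replaces `1`: `∑ ρ (e aᵢ) ⊗ hᵢ = ρ e ⊗ ∑ aᵢ hᵢ` by
-- right linearity of `ρ` and balancing, and `‖e‖ ≤ 1` bounds this uniformly in `e`.
lemma norm_unitorPre_le (hρ : ∀ a b, ρ (a * b) = rsmul (ρ a) b) (t : A ⊗[ℂ] H.space) :
    ‖unitorPre E F H ρ t‖ ≤ ‖assoc E F H‖ * ‖ρ‖ * ‖repMap H t‖ := by
  let := CStarAlgebra.spectralOrder A
  have := CStarAlgebra.spectralOrderedRing A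
  have h1 (e : A) : unitorPre E F H ρ (LinearMap.rTensor H.space (LinearMap.mulLeft ℂ e) t)
      = assoc E F H (ρ e) (repMap H t) := by
    refine TensorProduct.induction_on t (by simp) (fun a h => ?_) fun s t hs ht => ?_
    · rw [LinearMap.rTensor_tmul, unitorPre_tmul, LinearMap.mulLeft_apply, hρ, assoc_rsmul,
        repMap_tmul]
    · simp only [map_add, hs, ht]
  have h2 : Filter.Tendsto
      (fun e => unitorPre E F H ρ (LinearMap.rTensor H.space (LinearMap.mulLeft ℂ e) t))
      (CStarAlgebra.approximateUnit A) (nhds (unitorPre E F H ρ t)) := by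
    refine TensorProduct.induction_on t (by simp) (fun a h => ?_)
      fun s t hs ht => ?_
    · have hc : Continuous fun b : A => assoc E F H (ρ b) h := by fun_prop
      exact (hc.tendsto a).comp
        ((CStarAlgebra.increasingApproximateUnit A).tendsto_mul_right a)
    · simpa only [map_add] using hs.add ht
  refine le_of_tendsto h2.norm ?_
  filter_upwards [(CStarAlgebra.increasingApproximateUnit A).eventually_norm] with e he
  rw [h1]
  calc _ ≤ ‖assoc E F H‖ * ‖ρ e‖ * ‖repMap H t‖ := (assoc E F H).le_opNorm₂ _ _
    _ ≤ ‖assoc E F H‖ * (‖ρ‖ * 1) * ‖repMap H t‖ := by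
      gcongr
      exact (ρ.le_opNorm e).trans (by gcongr)
    _ = _ := by rw [mul_one]

/-- The map `a h ↦ ρ a ⊗ h`. -/
noncomputable def unitor : H.space →L[ℂ] (E.ind (F.ind H)).space :=
  (unitorPre E F H ρ).extendOfNorm (repMap H)

variable {ρ} in
lemma unitor_π (hρ : ∀ a b, ρ (a * b) = rsmul (ρ a) b) (a : A) (h : H.space) :
    unitor E F H ρ (H.π a h) = assoc E F H (ρ a) h :=
  LinearMap.extendOfNorm_eq (f := unitorPre E F H ρ) (denseRange_repMap H)
    ⟨_, norm_unitorPre_le E F H hρ⟩ (a ⊗ₜ h)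

variable {E F}

/-- Induction along an `A`-`B` and a `B`-`A` Hilbert bimodule whose interior tensor product is
isomorphic to the unit arrow is isomorphic to the identity functor. -/
lemma nonempty_id_iso_ind_comp_ind (φ : E.tensor F ≅ unit A) :
    Nonempty (𝟭 (CStarRep A) ≅ indFunctor F ⋙ indFunctor E) := by
  obtain ⟨g, hg⟩ := φ.hom.adjointable
  obtain ⟨g', hg'⟩ := φ.inv.adjointable
  have hg'' (a : A) (z : (E.tensor F).carrier) :
      form (B := A) (adjointLin (F := unit A) φ.hom.toLin g hg a) z
        = form (V := (unit A).carrier) a (φ.hom.toLin z) := by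
    rw [← star_form]
    exact (congrArg star (hg z a)).symm.trans (star_form (V := (unit A).carrier) _ _)
  -- `ρ` is the inverse of `φ` and `σ` is its adjoint; they agree only when `φ` is unitary. Both are
  -- bounded and right `A`-linear because both are adjointable.
  let ρ : A →L[ℂ] (E.tensor F).carrier :=
    ⟨φ.inv.toLin, continuous_of_adjoint (E := unit A) φ.inv.toLin g' hg'⟩
  let σ : A →L[ℂ] (E.tensor F).carrier :=
    ⟨adjointLin (F := unit A) φ.hom.toLin g hg,
      continuous_of_adjoint (E := unit A) (adjointLin (F := unit A) φ.hom.toLin g hg) _ hg''⟩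
  have hρ (a b : A) : ρ (a * b) = rsmul (ρ a) b :=
    map_rsmul_of_adjoint (E := unit A) φ.inv.toLin g' hg' a b
  have hσ (a b : A) : σ (a * b) = rsmul (σ a) b :=
    map_rsmul_of_adjoint (E := unit A) (adjointLin (F := unit A) φ.hom.toLin g hg) _ hg'' a b
  -- Moving the adjoint across gives `⟨a, φ (ρ b)⟩`, and `φ` undoes `ρ`.
  have hσρ (a b : A) : form (B := A) (σ a) (ρ b) = star a * b := by
    refine (hg'' a (ρ b)).trans ?_
    exact congrArg (fun f => form (V := (unit A).carrier) (B := A) a (Hom.toLin f b)) φ.inv_hom_id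
  have hρφ (z : (E.tensor F).carrier) : ρ (φ.hom.toLin z) = z :=
    congrArg (fun f => Hom.toLin f z) φ.hom_inv_id
  -- On total vectors, `⟨σ a ⊗ y, ρ b ⊗ x⟩ = ⟨y, star a * b x⟩ = ⟨a y, b x⟩`.
  have hleft (H : CStarRep A) (h : H.space) :
      ContinuousLinearMap.adjoint (unitor E F H σ) (unitor E F H ρ h) = h := by
    suffices hs : (ContinuousLinearMap.adjoint (unitor E F H σ)).comp (unitor E F H ρ)
        = ContinuousLinearMap.id ℂ H.space from DFunLike.congr_fun hs h
    refine rep_ext fun b x => (InnerProductSpace.toDual ℂ _).injective (rep_ext fun a y => ?_)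
    rw [InnerProductSpace.toDual_apply_apply, InnerProductSpace.toDual_apply_apply,
      ContinuousLinearMap.comp_apply, ContinuousLinearMap.adjoint_inner_left, unitor_π E F H hρ,
      unitor_π E F H hσ, ← inner_conj_symm, inner_assoc, hσρ, CStarRep.π_mul_apply,
      ← CStarRep.inner_π_left, inner_conj_symm]
    rfl
  -- By `hleft` the composite fixes the range of `unitor E F H ρ`. That range is dense because it
  -- contains each `z ⊗ h`, the image of `φ(z) h`.
  have hright (H : CStarRep A) (w : (E.ind (F.ind H)).space) :
      unitor E F H ρ (ContinuousLinearMap.adjoint (unitor E F H σ) w) = w := by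
    have hd : DenseRange (unitor E F H ρ) := by
      have hs : Submodule.span ℂ {w | ∃ z h, assoc E F H z h = w}
          ≤ LinearMap.range (unitor E F H ρ).toLinearMap := by
        rw [Submodule.span_le]
        rintro _ ⟨z, h, rfl⟩
        exact ⟨H.π (φ.hom.toLin z) h, (unitor_π E F H hρ _ h).trans (by rw [hρφ])⟩
      exact (dense_span_assoc E F H).mono hs
    refine hd.induction_on (p := fun w => unitor E F H ρ
      (ContinuousLinearMap.adjoint (unitor E F H σ) w) = w) w
      (isClosed_eq (by fun_prop) continuous_id) fun h => ?_
    rw [hleft]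
  let U (H : CStarRep A) : H ⟶ E.ind (F.ind H) := ⟨unitor E F H ρ, fun b => rep_ext fun a h => by
    rw [ContinuousLinearMap.comp_apply, ContinuousLinearMap.comp_apply, ← CStarRep.π_mul_apply,
      unitor_π E F H hρ, unitor_π E F H hρ, ← assoc_act]
    exact congrArg (fun z => assoc E F H z h) (φ.inv.map_act b a)⟩
  let V (H : CStarRep A) : E.ind (F.ind H) ⟶ H :=
    ⟨ContinuousLinearMap.adjoint (unitor E F H σ), fun b => ContinuousLinearMap.ext fun w => by
      rw [ContinuousLinearMap.comp_apply, ContinuousLinearMap.comp_apply]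
      -- The inverse of an intertwiner intertwines: `V b w = V b U V w = V U b V w = b V w`.
      conv_lhs => rw [← hright H w]
      exact (congrArg _ (CStarRep.hom_comm (U H) b _).symm).trans (hleft H _)⟩
  refine ⟨NatIso.ofComponents (fun H => ⟨U H, V H, ?_, ?_⟩) fun {H K} T => ?_⟩
  · exact CStarRep.hom_ext (ContinuousLinearMap.ext (hleft H))
  · exact CStarRep.hom_ext (ContinuousLinearMap.ext (hright H))
  · refine CStarRep.hom_ext (rep_ext fun a h => ?_)
    change unitor E F K ρ (T.toCLM (H.π a h))
      = (indHom E (indHom F T)).toCLM (unitor E F H ρ (H.π a h))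
    rw [CStarRep.hom_comm, unitor_π E F K hρ, unitor_π E F H hρ, assoc_natural]

end UnitIso

end HilbertBimodule

theorem theorem4p6 (A B : Type u) [NonUnitalCStarAlgebra A] [NonUnitalCStarAlgebra B]
    (hAB : IsomorphicInCStar A B) :
    ∃ G : CStarRep A ⥤ CStarRep B, G.IsEquivalence ∧ G.Additive ∧ G.Linear ℂ ∧
      ∀ (H K : CStarRep A) (T : H ⟶ K), G.map (CStarRep.adj T) = CStarRep.adj (G.map T) := by
  obtain ⟨E, F, ⟨φ⟩, ⟨ψ⟩⟩ := hAB
  obtain ⟨η⟩ := HilbertBimodule.nonempty_id_iso_ind_comp_ind φ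
  obtain ⟨ε⟩ := HilbertBimodule.nonempty_id_iso_ind_comp_ind ψ
  -- Induction is contravariant in the direction of the bimodule, so it is `F`, from `B` to `A`,
  -- that takes representations of `A` to representations of `B`.
  exact ⟨HilbertBimodule.indFunctor F,
    (CategoryTheory.Equivalence.mk (HilbertBimodule.indFunctor F) (HilbertBimodule.indFunctor E)
      η ε.symm).isEquivalence_functor,
    inferInstance, inferInstance, fun _ _ T => HilbertBimodule.indFunctor_map_adj F T⟩
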